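/- Let $\Omega\subset\mathbb R^2$ be a bounded domain with Lipschitz boundary, and let $\Gamma_D,\Gamma_N$ be disjoint relatively open subsets of $\partial\Omega$ with $\Gamma_D\neq\emptyset$ such that $\partial\Omega\setminus(\Gamma_D\cup\Gamma_N)$ is finite. Let $0<T<\infty$. Put $$\mathcal E(\overline\Omega)=\{u\in C^\infty(\overline\Omega)^2:\ \operatorname{div}u=0,\ \operatorname{supp}u\cap\overline{\Gamma_D}=\emptyset\},$$ and let $V_\kappa$ and $L^2_\kappa$ be the closures of $\mathcal E(\overline\Omega)$ in $W^{1,2}(\Omega)^2$ and in $L^2(\Omega)^2$. Write $(\cdot,\cdot)$ for the scalar product of $L^2(\Omega)^2$, $((w,v))=\int_\Omega\nabla w\cdot\nabla v\,dx$ and $\|w\|_{V_\kappa}=((w,w))^{1/2}$. Let $\mathcal D$ be the set of all $w\in V_\kappa$ for which there is an $f_w\in L^2_\kappa$ with $((w,v))=(f_w,v)$ for every $v\in V_\kappa$ (such an $f_w$ is unique), with the norm $\|w\|_{\mathcal D}=\|f_w\|_{L^2}$. Put $$X=\{u\in L^2(0,T;\mathcal D):\ u'\in L^2(0,T;L^2_\kappa)\},\qquad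 Y=L^2(0,T;L^2_\kappa)\times V_\kappa .$$ For $f\in L^2(0,T;L^2_\kappa)$ and $u_0\in V_\kappa$, a function $u\in X$ is called a generalized solution of the non-steady Stokes problem with mixed boundary conditions (with $u=0$ on $\Gamma_D$, $-\mathcal P n+\partial u/\partial n=0$ on $\Gamma_N$, viscosity $1$) if $$(u'(t),v)+((u(t),v))=(f(t),v)\quad\text{for all }v\in V_\kappa\text{ and almost every }t\in(0,T),\qquad u(0)=u_0,$$ where $u(0)$ is the value at $0$ of the representative of $u$ that is continuous from $[0,T]$ to $V_\kappa$. Theorem. There is a constant $c>0$, depending only on $\Omega,\Gamma_D,\Gamma_N,T$, such that for all $f\in L^2(0,T;L^2_\kappa)$ and $u_0\in V_\kappa$ there is a unique generalized solution $u\in X$, and it satisfies $$\|u\|_{L^2(0,T;\mathcal D)}+\|u\|_{L^\infty(0,T;V_\kappa)}+\|u'\|_{L^2(0,T;L^2_\kappa)}\le c\bigl(\|f\|_{L^2(0,T;L^2_\kappa)}+\|u_0\|_{V_\kappa}\bigr).$$ Moreover the operator $\mathcal S:X\to Y$, $\mathcal S(u)=\bigl[(u',\cdot)+((u,\cdot));\,u(0)\bigr]$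 (the functional $(u',\cdot)+((u,\cdot))$ being identified with the element of $L^2(0,T;L^2_\kappa)$ that represents it) is well defined and is a bijection of $X$ onto $Y$. -/

import Mathlib

open MeasureTheory Set Filter Topology
open scoped ENNReal ContDiff

noncomputable section

namespace MixedStokes

/-- The plane `ℝ²` with its Euclidean norm. -/
abbrev R2 : Type := EuclideanSpace ℝ (Fin 2)

/-- `2 × 2` matrices with the Frobenius inner product; the entry `(i, j)` of a velocity gradient
is `∂u_i/∂x_j`. -/
abbrev Mat2 : Type := EuclideanSpace ℝ (Fin 2 × Fin 2)

/-! ### The domain -/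

/-- `Ω` has a Lipschitz boundary (class `C^{0,1}`): near each of its boundary points, in suitable
Cartesian coordinates, `Ω` is the part of the plane below the graph of a Lipschitz function. -/
def HasLipschitzBoundary (Ω : Set R2) : Prop :=
  ∀ x₀ ∈ frontier Ω, ∃ (r : ℝ) (e : R2 ≃ₗᵢ[ℝ] R2) (g : ℝ → ℝ) (K : NNReal),
    0 < r ∧ LipschitzWith K g ∧
      ∀ x ∈ Metric.ball x₀ r, (x ∈ Ω ↔ (e x) 1 < g ((e x) 0))

/-- A bounded Lipschitz domain `Ω ⊂ ℝ²` whose boundary is, up to finitely many points, the union of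
two disjoint relatively open parts: `ΓD` (nonempty, fixed wall) and `ΓN` (input and output). -/
structure ChannelDomain where
  Ω : Set R2
  ΓD : Set R2
  ΓN : Set R2
  isOpen : IsOpen Ω
  isConnected : IsConnected Ω
  isBounded : Bornology.IsBounded Ω
  lipschitz : HasLipschitzBoundary Ω
  ΓD_open : ∃ U : Set R2, IsOpen U ∧ ΓD = frontier Ω ∩ U
  ΓN_open : ∃ U : Set R2, IsOpen U ∧ ΓN = frontier Ω ∩ U
  disjoint : Disjoint ΓD ΓN
  ΓD_nonempty : ΓD.Nonempty
  finite_rest : (frontier Ω \ (ΓD ∪ ΓN)).Finite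

/-! ### Function spaces on `Ω` -/

/-- `L²(Ω)²`. -/
abbrev L2Vec (Ω : Set R2) : Type := Lp R2 2 ((volume : Measure R2).restrict Ω)

/-- `L²(Ω)^{2×2}`. -/
abbrev L2Mat (Ω : Set R2) : Type := Lp Mat2 2 ((volume : Measure R2).restrict Ω)

/-- The partial derivative `∂φ/∂x_j`. -/
def partialDeriv (j : Fin 2) (φ : R2 → ℝ) (x : R2) : ℝ :=
  fderiv ℝ φ x (EuclideanSpace.single j 1)

/-- `G` is the weak gradient of `u` in `Ω`. -/
def IsWeakGradient (Ω : Set R2) (u : L2Vec Ω) (G : L2Mat Ω) : Prop :=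
  ∀ φ : R2 → ℝ, ContDiff ℝ ∞ φ → HasCompactSupport φ → tsupport φ ⊆ Ω → ∀ i j : Fin 2,
    ∫ x in Ω, u x i * partialDeriv j φ x = -∫ x in Ω, G x (i, j) * φ x

lemma memLp_continuous_compactSupport {f : R2 → ℝ} (hf : Continuous f)
    (hc : HasCompactSupport f) (μ : Measure R2) [IsFiniteMeasureOnCompacts μ] :
    MemLp f 2 μ :=
  hf.memLp_of_hasCompactSupport hc

lemma continuous_partialDeriv {φ : R2 → ℝ} (hφ : ContDiff ℝ ∞ φ) (j : Fin 2) :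
    Continuous (partialDeriv j φ) :=
  (hφ.continuous_fderiv (by simp)).clm_apply continuous_const

lemma hasCompactSupport_partialDeriv {φ : R2 → ℝ} (hc : HasCompactSupport φ) (j : Fin 2) :
    HasCompactSupport (partialDeriv j φ) :=
  hc.fderiv_apply (𝕜 := ℝ) _

lemma memLp_coord {ι : Type*} [Fintype ι] {μ : Measure R2} (u : Lp (EuclideanSpace ℝ ι) 2 μ)
    (i : ι) : MemLp (fun x => u x i) 2 μ :=
  (Lp.memLp u).continuousLinearMap_comp (EuclideanSpace.proj (𝕜 := ℝ) i)

lemma IsWeakGradient.add {Ω : Set R2} {u v : L2Vec Ω} {G H : L2Mat Ω}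
    (hu : IsWeakGradient Ω u G) (hv : IsWeakGradient Ω v H) :
    IsWeakGradient Ω (u + v) (G + H) := by
  intro φ hφ hc hs i j
  have hd := memLp_continuous_compactSupport (continuous_partialDeriv hφ j)
    (hasCompactSupport_partialDeriv hc j) (volume.restrict Ω)
  have h0 := memLp_continuous_compactSupport hφ.continuous hc (volume.restrict Ω)
  have e1 : ∫ x in Ω, (u + v : L2Vec Ω) x i * partialDeriv j φ x
      = ∫ x in Ω, (u x i * partialDeriv j φ x + v x i * partialDeriv j φ x) := by
    refine integral_congr_ae ?_
    filter_upwards [Lp.coeFn_add u v] with x hx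
    rw [hx]; simp [add_mul]
  have e2 : ∫ x in Ω, (G + H : L2Mat Ω) x (i, j) * φ x
      = ∫ x in Ω, (G x (i, j) * φ x + H x (i, j) * φ x) := by
    refine integral_congr_ae ?_
    filter_upwards [Lp.coeFn_add G H] with x hx
    rw [hx]; simp [add_mul]
  have e3 := integral_add ((memLp_coord u i).integrable_mul hd)
    ((memLp_coord v i).integrable_mul hd)
  have e4 := integral_add ((memLp_coord G (i, j)).integrable_mul h0)
    ((memLp_coord H (i, j)).integrable_mul h0)
  simp only [Pi.mul_apply] at e3 e4
  rw [e1, e2, e3, e4, hu φ hφ hc hs i j, hv φ hφ hc hs i j]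
  ring

lemma IsWeakGradient.smul {Ω : Set R2} {u : L2Vec Ω} {G : L2Mat Ω} (c : ℝ)
    (hu : IsWeakGradient Ω u G) : IsWeakGradient Ω (c • u) (c • G) := by
  intro φ hφ hc hs i j
  have e1 : ∫ x in Ω, (c • u : L2Vec Ω) x i * partialDeriv j φ x
      = ∫ x in Ω, c * (u x i * partialDeriv j φ x) := by
    refine integral_congr_ae ?_
    filter_upwards [Lp.coeFn_smul c u] with x hx
    rw [hx]; simp [mul_assoc]
  have e2 : ∫ x in Ω, (c • G : L2Mat Ω) x (i, j) * φ x
      = ∫ x in Ω, c * (G x (i, j) * φ x) := by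
    refine integral_congr_ae ?_
    filter_upwards [Lp.coeFn_smul c G] with x hx
    rw [hx]; simp [mul_assoc]
  rw [e1, e2, integral_const_mul, integral_const_mul, hu φ hφ hc hs i j]
  ring

lemma IsWeakGradient.zero (Ω : Set R2) : IsWeakGradient Ω 0 0 := by
  have h : ∀ {ι : Type} [Fintype ι] (i : ι) (g : R2 → ℝ),
      ∫ x in Ω, (0 : Lp (EuclideanSpace ℝ ι) 2 ((volume : Measure R2).restrict Ω)) x i * g x
        = 0 := by
    intro ι _ i g
    rw [← integral_zero R2 ℝ (μ := volume.restrict Ω)]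
    refine integral_congr_ae ?_
    filter_upwards [Lp.coeFn_zero (EuclideanSpace ℝ ι) 2 (volume.restrict Ω)] with x hx
    rw [hx]; simp
  intro φ _ _ _ i j
  rw [h, h, neg_zero]

/-- `W^{1,2}(Ω)²`: a function is recorded together with its weak gradient (which it determines), so
that the inner product is `(u, v)_{L²} + (∇u, ∇v)_{L²}`. -/
def W12 (Ω : Set R2) : Submodule ℝ (WithLp 2 (L2Vec Ω × L2Mat Ω)) where
  carrier := {p | IsWeakGradient Ω p.fst p.snd}
  zero_mem' := IsWeakGradient.zero Ω
  add_mem' := fun hp hq => IsWeakGradient.add hp hq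
  smul_mem' := fun c _ hp => IsWeakGradient.smul c hp

/-- The space `𝓔(Ω̄)` of smooth divergence-free vector fields on `Ω̄` whose support does not meet
the closure of `ΓD`; the fields in `C^∞(Ω̄)²` are the restrictions of fields in `C^∞(ℝ²)²`. -/
def smoothFields (Ω ΓD : Set R2) : Set (R2 → R2) :=
  {u | ContDiff ℝ ∞ u ∧
    (∀ x ∈ Ω, ∑ i : Fin 2, partialDeriv i (fun y => u y i) x = 0) ∧
    closure (closure Ω ∩ Function.support u) ∩ closure ΓD = ∅}

lemma smoothFields_zero (Ω ΓD : Set R2) : (0 : R2 → R2) ∈ smoothFields Ω ΓD := by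
  refine ⟨contDiff_const, fun x _ => ?_, ?_⟩
  · simp [partialDeriv]
  · simp

lemma smoothFields_add {Ω ΓD : Set R2} {u v : R2 → R2} (hu : u ∈ smoothFields Ω ΓD)
    (hv : v ∈ smoothFields Ω ΓD) : u + v ∈ smoothFields Ω ΓD := by
  obtain ⟨hu1, hu2, hu3⟩ := hu
  obtain ⟨hv1, hv2, hv3⟩ := hv
  refine ⟨hu1.add hv1, fun x hx => ?_, ?_⟩
  · have hd : ∀ (w : R2 → R2), ContDiff ℝ ∞ w → ∀ i : Fin 2,
        DifferentiableAt ℝ (fun y => w y i) x := by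
      intro w hw i
      exact ((EuclideanSpace.proj (𝕜 := ℝ) i).contDiff.comp hw).differentiable (by simp) x
    rw [← add_zero (0 : ℝ)]
    nth_rewrite 1 [← hu2 x hx]
    rw [← hv2 x hx, ← Finset.sum_add_distrib]
    refine Finset.sum_congr rfl fun i _ => ?_
    have := fderiv_fun_add (hd u hu1 i) (hd v hv1 i)
    simp only [partialDeriv, Pi.add_apply, PiLp.add_apply, this, add_apply]
  · rw [← Set.subset_empty_iff]
    rintro x ⟨hx, hxD⟩
    have hsub : closure Ω ∩ Function.support (u + v) ⊆
        (closure Ω ∩ Function.support u) ∪ (closure Ω ∩ Function.support v) := by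
      rw [← Set.inter_union_distrib_left]
      exact Set.inter_subset_inter_right _ (Function.support_add u v)
    have := closure_mono hsub hx
    rw [closure_union] at this
    rcases this with h | h
    · exact hu3 ▸ (⟨h, hxD⟩ : x ∈ closure (closure Ω ∩ Function.support u) ∩ closure ΓD)
    · exact hv3 ▸ (⟨h, hxD⟩ : x ∈ closure (closure Ω ∩ Function.support v) ∩ closure ΓD)

lemma smoothFields_smul {Ω ΓD : Set R2} {u : R2 → R2} (c : ℝ) (hu : u ∈ smoothFields Ω ΓD) :
    c • u ∈ smoothFields Ω ΓD := by
  obtain ⟨hu1, hu2, hu3⟩ := hu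
  refine ⟨hu1.const_smul c, fun x hx => ?_, ?_⟩
  · rw [← mul_zero c, ← hu2 x hx, Finset.mul_sum]
    refine Finset.sum_congr rfl fun i _ => ?_
    have hd : DifferentiableAt ℝ (fun y => u y i) x :=
      ((EuclideanSpace.proj (𝕜 := ℝ) i).contDiff.comp hu1).differentiable (by simp) x
    have := fderiv_const_mul hd c
    simp only [partialDeriv, Pi.smul_apply, PiLp.smul_apply, smul_eq_mul, this,
      smul_apply]
  · rw [← Set.subset_empty_iff]
    rintro x ⟨hx, hxD⟩
    have := closure_mono (Set.inter_subset_inter_right (closure Ω)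
      (Function.support_const_smul_subset c u)) hx
    exact hu3 ▸ (⟨this, hxD⟩ : x ∈ closure (closure Ω ∩ Function.support u) ∩ closure ΓD)

/-- `𝓔(Ω̄)` as a subspace of `L²(Ω)²`. -/
def smoothL2 (Ω ΓD : Set R2) : Submodule ℝ (L2Vec Ω) where
  carrier := {w | ∃ u ∈ smoothFields Ω ΓD, w =ᵐ[volume.restrict Ω] u}
  zero_mem' := ⟨0, smoothFields_zero Ω ΓD, Lp.coeFn_zero _ _ _⟩
  add_mem' := by
    rintro a b ⟨u, hu, hau⟩ ⟨v, hv, hbv⟩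
    exact ⟨u + v, smoothFields_add hu hv, (Lp.coeFn_add a b).trans (hau.add hbv)⟩
  smul_mem' := by
    rintro c a ⟨u, hu, hau⟩
    exact ⟨c • u, smoothFields_smul c hu, (Lp.coeFn_smul c a).trans (hau.const_smul c)⟩

/-- `𝓔(Ω̄)` as a subspace of `W^{1,2}(Ω)²`. -/
def smoothW12 (Ω ΓD : Set R2) : Submodule ℝ (W12 Ω) :=
  (smoothL2 Ω ΓD).comap ((WithLp.fstₗ 2 ℝ (L2Vec Ω) (L2Mat Ω)).comp (W12 Ω).subtype)

/-- `L²_κ`: the closure of `𝓔(Ω̄)` in `L²(Ω)²`, with the scalar product of `L²(Ω)²`. -/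
def Lkappa (P : ChannelDomain) : Type := (smoothL2 P.Ω P.ΓD).topologicalClosure

instance (P : ChannelDomain) : NormedAddCommGroup (Lkappa P) :=
  inferInstanceAs (NormedAddCommGroup (smoothL2 P.Ω P.ΓD).topologicalClosure)

instance (P : ChannelDomain) : InnerProductSpace ℝ (Lkappa P) :=
  inferInstanceAs (InnerProductSpace ℝ (smoothL2 P.Ω P.ΓD).topologicalClosure)

instance (P : ChannelDomain) : CompleteSpace (Lkappa P) :=
  inferInstanceAs (CompleteSpace (smoothL2 P.Ω P.ΓD).topologicalClosure)

/-- `V_κ`: the closure of `𝓔(Ω̄)` in `W^{1,2}(Ω)²`. As a topological vector space it carries the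
norm of `W^{1,2}(Ω)²`; its (equivalent) gradient scalar product and norm are `gradInner` and
`normV` below. -/
def Vkappa (P : ChannelDomain) : Type := (smoothW12 P.Ω P.ΓD).topologicalClosure

instance (P : ChannelDomain) : NormedAddCommGroup (Vkappa P) :=
  inferInstanceAs (NormedAddCommGroup (smoothW12 P.Ω P.ΓD).topologicalClosure)

instance (P : ChannelDomain) : InnerProductSpace ℝ (Vkappa P) :=
  inferInstanceAs (InnerProductSpace ℝ (smoothW12 P.Ω P.ΓD).topologicalClosure)

/-- The underlying vector field `w ∈ L²(Ω)²` of `w ∈ V_κ`. -/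
def field {P : ChannelDomain} (w : Vkappa P) : L2Vec P.Ω := w.1.1.fst

/-- The gradient `∇w ∈ L²(Ω)^{2×2}` of `w ∈ V_κ`. -/
def grad {P : ChannelDomain} (w : Vkappa P) : L2Mat P.Ω := w.1.1.snd

/-- The scalar product `((w, v)) = ∫_Ω ∇w · ∇v` of `V_κ`. -/
def gradInner {P : ChannelDomain} (w v : Vkappa P) : ℝ := inner ℝ (grad w) (grad v)

/-- The norm `‖w‖_{V_κ} = ((w, w))^{1/2}`. -/
def normV {P : ChannelDomain} (w : Vkappa P) : ℝ := Real.sqrt (gradInner w w)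

lemma field_mem {P : ChannelDomain} (w : Vkappa P) :
    field w ∈ (smoothL2 P.Ω P.ΓD).topologicalClosure := by
  have hc : Continuous fun p : W12 P.Ω => (p : WithLp 2 (L2Vec P.Ω × L2Mat P.Ω)).fst :=
    (WithLp.prod_continuous_ofLp 2 _ _).fst.comp continuous_subtype_val
  exact map_mem_closure (f := fun p : W12 P.Ω => (p : WithLp 2 (L2Vec P.Ω × L2Mat P.Ω)).fst)
    hc w.2 (fun p hp => hp)

/-- The inclusion `V_κ ⊂ L²_κ`. -/
def toLkappa {P : ChannelDomain} (w : Vkappa P) : Lkappa P := ⟨field w, field_mem w⟩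

/-! ### The space `𝓓` -/

/-- `f ∈ L²_κ` corresponds to `w ∈ V_κ`: `((w, v)) = (f, v)` for every `v ∈ V_κ`. -/
def Corresponds {P : ChannelDomain} (w : Vkappa P) (f : Lkappa P) : Prop :=
  ∀ v : Vkappa P, gradInner w v = inner ℝ f (toLkappa v)

lemma memLp_of_contDiff {Ω : Set R2} (hb : Bornology.IsBounded Ω) (hm : MeasurableSet Ω)
    {F : Type*} [NormedAddCommGroup F] [SecondCountableTopology F]
    {u : R2 → F} (hu : Continuous u) :
    MemLp u 2 (volume.restrict Ω) := by
  have : IsFiniteMeasure ((volume : Measure R2).restrict Ω) :=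
    ⟨by rw [Measure.restrict_apply_univ]; exact hb.measure_lt_top⟩
  obtain ⟨C, hC⟩ := hb.isCompact_closure.exists_bound_of_continuousOn hu.continuousOn
  refine MemLp.of_bound (hu.aestronglyMeasurable (α := R2)) C ?_
  filter_upwards [ae_restrict_mem hm] with x hx
  exact hC x (subset_closure hx)

/-- Every element of `𝓔(Ω̄)`, as a class in `L²(Ω)²`, comes from an element of `V_κ`. -/
lemma exists_Vkappa_of_smooth (P : ChannelDomain) {w : L2Vec P.Ω} (hw : w ∈ smoothL2 P.Ω P.ΓD) :
    ∃ v : Vkappa P, field v = w := by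
  obtain ⟨u, hu, hwu⟩ := hw
  have hm := P.isOpen.measurableSet
  have hui : ∀ i : Fin 2, ContDiff ℝ ∞ fun y => u y i := fun i =>
    (EuclideanSpace.proj (𝕜 := ℝ) i).contDiff.comp hu.1
  set G : R2 → Mat2 := fun x =>
    WithLp.toLp 2 fun ij : Fin 2 × Fin 2 => partialDeriv ij.2 (fun y => u y ij.1) x with hG
  have hGc : Continuous G := (PiLp.continuous_toLp 2 _).comp
    (continuous_pi fun ij => continuous_partialDeriv (hui ij.1) ij.2)
  have hGL : MemLp G 2 (volume.restrict P.Ω) := memLp_of_contDiff P.isBounded hm hGc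
  have hwg : IsWeakGradient P.Ω w (hGL.toLp G) := by
    intro φ hφ hc hs i j
    have e1 : ∫ x in P.Ω, w x i * partialDeriv j φ x = ∫ x, u x i * partialDeriv j φ x := by
      rw [← setIntegral_eq_integral_of_forall_compl_eq_zero (s := P.Ω)
        (f := fun x => u x i * partialDeriv j φ x)]
      · refine integral_congr_ae ?_
        filter_upwards [hwu] with x hx
        rw [hx]
      · intro x hx
        have : fderiv ℝ φ x = 0 := fderiv_of_notMem_tsupport (𝕜 := ℝ) fun h => hx (hs h)
        simp [partialDeriv, this]
    have e2 : ∫ x in P.Ω, (hGL.toLp G : L2Mat P.Ω) x (i, j) * φ x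
        = ∫ x, partialDeriv j (fun y => u y i) x * φ x := by
      rw [← setIntegral_eq_integral_of_forall_compl_eq_zero (s := P.Ω)
        (f := fun x => partialDeriv j (fun y => u y i) x * φ x)]
      · refine integral_congr_ae ?_
        filter_upwards [hGL.coeFn_toLp] with x hx
        rw [hx]
      · intro x hx
        rw [image_eq_zero_of_notMem_tsupport (fun h => hx (hs h)), mul_zero]
    rw [e1, e2]
    exact integral_mul_fderiv_eq_neg_fderiv_mul_of_integrable
      (((continuous_partialDeriv (hui i) j).mul hφ.continuous).integrable_of_hasCompactSupport
        hc.mul_left)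
      (((hui i).continuous.mul (continuous_partialDeriv hφ j)).integrable_of_hasCompactSupport
        (hasCompactSupport_partialDeriv hc j).mul_left)
      (((hui i).continuous.mul hφ.continuous).integrable_of_hasCompactSupport hc.mul_left)
      (fun x _ => (hui i).differentiable (by simp) x)
      (fun x _ => hφ.differentiable (by simp) x)
  refine ⟨⟨⟨WithLp.toLp 2 (w, hGL.toLp G), hwg⟩, subset_closure ?_⟩, rfl⟩
  exact ⟨u, hu, hwu⟩

lemma denseRange_toLkappa (P : ChannelDomain) : DenseRange (toLkappa (P := P)) := by
  intro f
  rw [Metric.mem_closure_iff]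
  intro ε hε
  obtain ⟨w, hw, hd⟩ := Metric.mem_closure_iff.1 f.2 ε hε
  obtain ⟨v, rfl⟩ := exists_Vkappa_of_smooth P hw
  exact ⟨toLkappa v, ⟨v, rfl⟩, hd⟩

/-- At most one `f` corresponds to a given `w`. -/
lemma Corresponds.unique {P : ChannelDomain} {w : Vkappa P} {f g : Lkappa P}
    (hf : Corresponds w f) (hg : Corresponds w g) : f = g := by
  refine (denseRange_toLkappa P).eq_of_inner_left ℝ fun v => ?_
  rw [← hf v, ← hg v]

/-- The space `𝓓` of all `w ∈ V_κ` to which some `f ∈ L²_κ` corresponds. -/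
def spaceD (P : ChannelDomain) : Set (Vkappa P) := {w | ∃ f : Lkappa P, Corresponds w f}

open Classical in
/-- The `f ∈ L²_κ` corresponding to `w ∈ 𝓓`; the norm of `𝓓` is `‖w‖_𝓓 = ‖f‖`. -/
def dataOf {P : ChannelDomain} (w : Vkappa P) : Lkappa P :=
  if h : w ∈ spaceD P then h.choose else 0

/-! ### Function spaces on `(0, T)` -/

/-- Lebesgue measure on `(0, T)`. -/
abbrev timeMeasure (T : ℝ) : Measure ℝ := volume.restrict (Ioo 0 T)

/-- `L²(0, T; L²_κ)`. -/
abbrev L2Lkappa (P : ChannelDomain) (T : ℝ) : Type := Lp (Lkappa P) 2 (timeMeasure T)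

/-- `L²(0, T; V_κ)`. -/
abbrev L2Vkappa (P : ChannelDomain) (T : ℝ) : Type := Lp (Vkappa P) 2 (timeMeasure T)

/-- `u ∈ L²(0, T; 𝓓)`. As `𝓓` carries the norm that makes `w ↦ dataOf w` isometric, this means that
`u(t) ∈ 𝓓` for almost every `t` and that `t ↦ dataOf (u t)` is strongly measurable and
square integrable. -/
def MemL2D {P : ChannelDomain} {T : ℝ} (u : L2Vkappa P T) : Prop :=
  (∀ᵐ t ∂timeMeasure T, u t ∈ spaceD P) ∧ MemLp (fun t => dataOf (u t)) 2 (timeMeasure T)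

/-- `g = u'` in the sense of `L²_κ`-valued distributions on `(0, T)`. -/
def IsTimeDeriv {P : ChannelDomain} {T : ℝ} (u : L2Vkappa P T) (g : L2Lkappa P T) : Prop :=
  ∀ φ : ℝ → ℝ, ContDiff ℝ ∞ φ → HasCompactSupport φ → tsupport φ ⊆ Ioo 0 T →
    ∫ t in Ioo 0 T, deriv φ t • toLkappa (u t) = -∫ t in Ioo 0 T, φ t • g t

/-- The derivative `u'` is unique. -/
lemma IsTimeDeriv.unique {P : ChannelDomain} {T : ℝ} {u : L2Vkappa P T} {g h : L2Lkappa P T}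
    (hg : IsTimeDeriv u g) (hh : IsTimeDeriv u h) : g = h := by
  have hint : ∀ k : L2Lkappa P T, Integrable k (timeMeasure T) := fun k =>
    (Lp.memLp k).integrable (by norm_num)
  have hsm : ∀ (k : L2Lkappa P T) (φ : ℝ → ℝ), ContDiff ℝ ∞ φ → HasCompactSupport φ →
      Integrable (fun t => φ t • k t) (timeMeasure T) := by
    intro k φ hφ hc
    obtain ⟨C, hC⟩ := hc.exists_bound_of_continuous hφ.continuous
    exact (hint k).bdd_smul C hφ.continuous.aestronglyMeasurable (ae_of_all _ hC)
  have key := isOpen_Ioo.ae_eq_zero_of_integral_contDiff_smul_eq_zero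
    (U := Ioo 0 T) (f := fun t => g t - h t) (μ := timeMeasure T)
    (((hint g).sub (hint h)).locallyIntegrable.locallyIntegrableOn _) (by
      intro φ hφ hc hs
      simp only [smul_sub]
      rw [integral_sub (hsm g φ hφ hc) (hsm h φ hφ hc), sub_eq_zero]
      exact neg_injective ((hg φ hφ hc hs).symm.trans (hh φ hφ hc hs)))
  refine Lp.ext ?_
  filter_upwards [key, ae_restrict_mem measurableSet_Ioo] with t ht hmem
  exact sub_eq_zero.1 (ht hmem)

/-- The space `X = {u ∈ L²(0, T; 𝓓) : u' ∈ L²(0, T; L²_κ)}`. -/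
def SpaceX (P : ChannelDomain) (T : ℝ) : Type :=
  {u : L2Vkappa P T // MemL2D u ∧ ∃ g : L2Lkappa P T, IsTimeDeriv u g}

/-- The space `Y = L²(0, T; L²_κ) × V_κ`. -/
abbrev SpaceY (P : ChannelDomain) (T : ℝ) : Type := L2Lkappa P T × Vkappa P

/-- The derivative `u' ∈ L²(0, T; L²_κ)` of `u ∈ X`. -/
def timeDeriv {P : ChannelDomain} {T : ℝ} (u : SpaceX P T) : L2Lkappa P T := u.2.2.choose

/-- `u(0) = u₀`: the continuous function `[0, T] → V_κ` that represents `u` takes the value `u₀`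
at `0`. -/
def HasInitialValue {P : ChannelDomain} {T : ℝ} (u : SpaceX P T) (u₀ : Vkappa P) : Prop :=
  ∃ U : ℝ → Vkappa P, ContinuousOn U (Icc 0 T) ∧ (∀ᵐ t ∂timeMeasure T, u.1 t = U t) ∧ U 0 = u₀

/-- `‖u‖_{L²(0, T; 𝓓)}`. -/
def normL2D {P : ChannelDomain} {T : ℝ} (u : SpaceX P T) : ℝ≥0∞ :=
  eLpNorm (fun t => dataOf (u.1 t)) 2 (timeMeasure T)

/-- `‖u‖_{L^∞(0, T; V_κ)}` (equal to `∞` if `u` is not essentially bounded). -/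
def normLinftyV {P : ChannelDomain} {T : ℝ} (u : SpaceX P T) : ℝ≥0∞ :=
  eLpNorm (fun t => normV (u.1 t)) ∞ (timeMeasure T)

/-- `‖u'‖_{L²(0, T; L²_κ)}`. -/
def normDerivL2 {P : ChannelDomain} {T : ℝ} (u : SpaceX P T) : ℝ≥0∞ :=
  eLpNorm (timeDeriv u) 2 (timeMeasure T)

/-! ### The non-steady Stokes problem -/

/-- `(u'(t), v) + ((u(t), v)) = (f(t), v)` for all `v ∈ V_κ` and almost every `t ∈ (0, T)`. -/
def SatisfiesStokes {P : ChannelDomain} {T : ℝ} (u : SpaceX P T) (f : L2Lkappa P T) : Prop :=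
  ∀ᵐ t ∂timeMeasure T, ∀ v : Vkappa P,
    inner ℝ (timeDeriv u t) (toLkappa v) + gradInner (u.1 t) v = inner ℝ (f t) (toLkappa v)

/-- `u ∈ X` is a generalized solution of the non-steady Stokes problem with mixed boundary
conditions, right-hand side `f` and initial velocity `u₀`. -/
def IsGeneralizedSolution {P : ChannelDomain} {T : ℝ} (u : SpaceX P T) (f : L2Lkappa P T)
    (u₀ : Vkappa P) : Prop :=
  SatisfiesStokes u f ∧ HasInitialValue u u₀

/-- `S` is the operator `𝓢 : X → Y`, `𝓢(u) = [(u', ·) + ((u, ·)); u(0)]`, where the functional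
`(u', ·) + ((u, ·))` is identified with the element of `L²(0, T; L²_κ)` that represents it. -/
def IsStokesOperator {P : ChannelDomain} {T : ℝ} (S : SpaceX P T → SpaceY P T) : Prop :=
  ∀ u : SpaceX P T, SatisfiesStokes u (S u).1 ∧ HasInitialValue u (S u).2

end MixedStokes

end

/-!
Write `H = L²_κ`, `V = V_κ` with the scalar product of `W^{1,2}`, and `j : V → H` for the inclusion,
which is bounded, injective and has dense range. Let `A` be the operator in `H` given by the
form `((·, ·))`, so that `𝓓` is its domain and `dataOf w = A w`. Then `J = j j*` is the resolvent
`(1 + A)⁻¹`, a bounded injective self-adjoint operator with `0 ≤ J ≤ 1`, and `A w = f` means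
`w = j* (f + w)` (`corresponds_iff`). The Stokes problem becomes the evolution equation
`u' + A u = f` in `H` with `u(0) ∈ V`. Neither Poincaré's inequality nor a compact embedding is
needed, hence no property of the boundary either.

*Continuity in time and energy identity* (`exists_continuous_representative`). By the lemma of
du Bois-Reymond, `u` is `z(t) = a + ∫₀ᵗ u'` in `H`, and `z = J p` with `p = u + A u` in
`L²(0, T; H)`. The functions `(J + ε)⁻¹ z` are continuous with derivative `(J + ε)⁻¹ u'`, so
quadratic forms of bounded operators in them obey the product rule (`inner_clm_prim_self`). As
`J (J + ε)⁻¹ → 1` strongly (`IsRegularizer.tendsto`), the `V`-valued functions `j* (J + ε)⁻¹ z` are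
uniformly Cauchy; the limit represents `u`, and
`‖u(t)‖²_{V_κ} = ‖u(0)‖²_{V_κ} + 2 ∫₀ᵗ (A u, u')`.

*Estimate and uniqueness* (`IsGeneralizedSolution.energy_le`, `IsGeneralizedSolution.unique`). With
`A u = f - u'` and `2 (f, u') ≤ ‖f‖² + ‖u'‖²`, the identity gives
`‖u(t)‖²_{V_κ} + ∫₀ᵗ ‖u'‖² ≤ ‖u₀‖²_{V_κ} + ∫₀ᵗ ‖f‖²`, which bounds all three norms of `u`. With zero
data `u' = 0`, so `u` is constant and equal to `u(0) = 0`.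

*Existence* (`exists_solution`). With the bounded operator `(1 - J) (J + ε)⁻¹` in place of `A` the
equation is solved by the Lax–Milgram theorem in `L²(0, T; H)`, because `q ↦ ∫₀ᵗ q` is accretive.
Testing with `u'` bounds `u'` in `L²(0, T; H)` independently of `ε`. A weak limit of these
derivatives solves the equation, in the form `J u' + (1 - J) u = J f`.
-/

noncomputable section

namespace MixedStokes

open scoped InnerProductSpace

/-! ### Operators on a Hilbert space -/

section Hilbert

variable {E : Type*} [NormedAddCommGroup E] [InnerProductSpace ℝ E] [CompleteSpace E]

/-- The Lax–Milgram theorem for a bounded operator. -/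
lemma exists_inverse_of_coercive (A : E →L[ℝ] E) {c : ℝ} (hc : 0 < c)
    (h : ∀ x, c * ‖x‖ ^ 2 ≤ ⟪A x, x⟫_ℝ) :
    ∃ R : E →L[ℝ] E, (∀ x, A (R x) = x) ∧ ∀ x, R (A x) = x := by
  have hu : IsUnit A := by
    refine A.isUnit_of_forall_le_norm_inner_map (c := ⟨c, hc.le⟩) hc fun x => ?_
    have := (h x).trans (le_abs_self _)
    rw [Real.norm_eq_abs]
    exact (mul_comm _ _).le.trans this
  obtain ⟨u, rfl⟩ := hu
  refine ⟨(↑u⁻¹ : E →L[ℝ] E), fun x => ?_, fun x => ?_⟩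
  · rw [← mul_apply_eq_comp, u.mul_inv]; rfl
  · rw [← mul_apply_eq_comp, u.inv_mul]; rfl

/-- Weak compactness of balls, with the limit taken along an ultrafilter instead of a subsequence. -/
lemma exists_weak_limit (x : ℕ → E) (C : ℝ) (hx : ∀ n, ‖x n‖ ≤ C) :
    ∃ y : E, ∀ z, Tendsto (fun n => ⟪x n, z⟫_ℝ) (hyperfilter ℕ) (𝓝 ⟪y, z⟫_ℝ) := by
  let d : ℕ → WeakDual ℝ E := fun n => StrongDual.toWeakDual (InnerProductSpace.toDual ℝ E (x n))
  have hc := WeakDual.isCompact_closedBall (𝕜 := ℝ) (E := E) 0 C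
  obtain ⟨y, -, hy⟩ := hc.ultrafilter_le_nhds ((hyperfilter ℕ).map d) (by
    rw [le_principal_iff, Ultrafilter.coe_map, mem_map]
    refine Filter.univ_mem' fun n => ?_
    simpa [d] using hx n)
  refine ⟨(InnerProductSpace.toDual ℝ E).symm (WeakDual.toStrongDual y), fun z => ?_⟩
  rw [InnerProductSpace.toDual_symm_apply]
  have h2 : Tendsto d (hyperfilter ℕ) (𝓝 y) := hy
  exact ((WeakDual.eval_continuous z).tendsto y).comp h2

/-- The regularization parameter `1 / (n + 1)`. -/
def eps (n : ℕ) : ℝ := 1 / ((n : ℝ) + 1)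

lemma eps_pos (n : ℕ) : 0 < eps n := Nat.one_div_pos_of_nat

lemma tendsto_eps : Tendsto eps atTop (𝓝 0) := tendsto_one_div_add_atTop_nhds_zero_nat

/-- `R n` is a two-sided inverse of `J + 1 / (n + 1)`. -/
structure IsRegularizer (J : E →L[ℝ] E) (R : ℕ → E →L[ℝ] E) : Prop where
  right : ∀ n x, J (R n x) + eps n • R n x = x
  left : ∀ n x, R n (J x) + eps n • R n x = x

lemma exists_regularizer (J : E →L[ℝ] E) (hJ : ∀ x, 0 ≤ ⟪J x, x⟫_ℝ) :
    ∃ R : ℕ → E →L[ℝ] E, IsRegularizer J R := by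
  have h : ∀ n, ∃ R : E →L[ℝ] E, (∀ x, (J + eps n • 1) (R x) = x) ∧
      ∀ x, R ((J + eps n • 1 : E →L[ℝ] E) x) = x := fun n =>
    exists_inverse_of_coercive _ (eps_pos n) fun x => by
      simp only [add_apply, smul_apply,
        one_apply_eq_self, inner_add_left, real_inner_smul_left,
        real_inner_self_eq_norm_sq]
      linarith [hJ x]
  choose R h1 h2 using h
  exact ⟨R, fun n x => by simpa using h1 n x, fun n x => by simpa using h2 n x⟩

/-- For an injective nonnegative self-adjoint `J`, the operators `J (J + ε)⁻¹` converge strongly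
to the identity: they do so with rate `ε` on the range of `J`, which is dense. -/
lemma IsRegularizer.tendsto {J : E →L[ℝ] E} {R : ℕ → E →L[ℝ] E} (hR : IsRegularizer J R)
    (hs : ∀ x y, ⟪J x, y⟫_ℝ = ⟪x, J y⟫_ℝ) (hJ : ∀ x, 0 ≤ ⟪J x, x⟫_ℝ)
    (hi : Function.Injective J) (x : E) :
    Tendsto (fun n => J (R n x)) atTop (𝓝 x) := by
  -- `1 - J (J + ε)⁻¹ = ε (J + ε)⁻¹` is a contraction, and it is small on the range of `J`.
  have hb : ∀ n y, ‖eps n • R n y‖ ≤ ‖y‖ := by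
    intro n y
    have h0 := hJ (R n y)
    have h1 : ⟪y, eps n • R n y⟫_ℝ = ⟪J (R n y), eps n • R n y⟫_ℝ + ‖eps n • R n y‖ ^ 2 := by
      nth_rewrite 1 [← hR.right n y]
      rw [inner_add_left, real_inner_self_eq_norm_sq]
    rw [real_inner_smul_right (J (R n y))] at h1
    have h2 := real_inner_le_norm y (eps n • R n y)
    have h3 := mul_nonneg (eps_pos n).le h0
    by_contra! hlt
    nlinarith [norm_nonneg y, norm_nonneg (eps n • R n y)]
  have hd : DenseRange J := by
    have h1 : (J : E →ₗ[ℝ] E).IsSymmetric := hs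
    have h2 : (LinearMap.range (J : E →ₗ[ℝ] E)).topologicalClosure = ⊤ := by
      rw [Submodule.topologicalClosure_eq_top_iff, h1.orthogonal_range, LinearMap.ker_eq_bot]
      exact hi
    have h3 := (Submodule.dense_iff_topologicalClosure_eq_top).2 h2
    exact h3
  have he : Tendsto (fun n => eps n • R n x) atTop (𝓝 0) := by
    rw [Metric.tendsto_atTop]
    intro η hη
    obtain ⟨y, hy⟩ := hd.exists_dist_lt x (half_pos hη)
    have h1 : Tendsto (fun n => eps n * (2 * ‖y‖)) atTop (𝓝 0) := by
      simpa using tendsto_eps.mul_const (2 * ‖y‖)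
    obtain ⟨N, hN⟩ := Metric.tendsto_atTop.1 h1 (η / 2) (half_pos hη)
    refine ⟨N, fun n hn => ?_⟩
    have h2 := hN n hn
    rw [Real.dist_eq, sub_zero] at h2
    have h3 : R n (J y) = y - eps n • R n y := eq_sub_of_add_eq (hR.left n y)
    have h4 : ‖R n (J y)‖ ≤ 2 * ‖y‖ := by
      rw [h3]
      linarith [norm_sub_le y (eps n • R n y), hb n y]
    have h5 : eps n • R n x = eps n • R n (x - J y) + eps n • R n (J y) := by
      rw [← smul_add, ← map_add, sub_add_cancel]
    rw [dist_zero_right, h5]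
    have h6 : ‖eps n • R n (J y)‖ ≤ eps n * (2 * ‖y‖) := by
      rw [norm_smul, Real.norm_of_nonneg (eps_pos n).le]
      exact mul_le_mul_of_nonneg_left h4 (eps_pos n).le
    rw [dist_eq_norm] at hy
    linarith [norm_add_le (eps n • R n (x - J y)) (eps n • R n (J y)), hb n (x - J y),
      le_abs_self (eps n * (2 * ‖y‖))]
  have : (fun n => J (R n x)) = fun n => x - eps n • R n x :=
    funext fun n => eq_sub_of_add_eq (hR.right n x)
  rw [this]
  simpa using tendsto_const_nhds.sub he

end Hilbert

/-! ### Integration in time -/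

section Time

variable {H : Type*} [NormedAddCommGroup H]

lemma memLp_mono_time {q : ℝ → H} {T t : ℝ} (hq : MemLp q 2 (timeMeasure T)) (ht : t ≤ T) :
    MemLp q 2 (timeMeasure t) :=
  hq.mono_measure (Measure.restrict_mono (Ioo_subset_Ioo_right ht) le_rfl)

lemma integrable_of_memLp_time {q : ℝ → H} {T : ℝ} (hq : MemLp q 2 (timeMeasure T)) :
    Integrable q (timeMeasure T) := hq.integrable (by norm_num)

lemma integrable_smul_of_memLp [NormedSpace ℝ H] {q : ℝ → H} {T : ℝ}
    (hq : MemLp q 2 (timeMeasure T)) {φ : ℝ → ℝ} (hφ : Continuous φ) (hc : HasCompactSupport φ) :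
    Integrable (fun t => φ t • q t) (timeMeasure T) := by
  obtain ⟨C, hC⟩ := hc.exists_bound_of_continuous hφ
  exact (integrable_of_memLp_time hq).bdd_smul C hφ.aestronglyMeasurable (ae_of_all _ hC)

lemma memLp_of_continuousOn {q : ℝ → H} {T : ℝ} (hq : ContinuousOn q (Icc 0 T)) :
    MemLp q 2 (timeMeasure T) := by
  obtain ⟨C, hC⟩ := isCompact_Icc.exists_bound_of_continuousOn hq
  refine MemLp.of_bound ((hq.mono Ioo_subset_Icc_self).aestronglyMeasurable measurableSet_Ioo) C ?_
  filter_upwards [ae_restrict_mem measurableSet_Ioo] with t ht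
  exact hC t (Ioo_subset_Icc_self ht)

lemma intervalIntegrable_of_memLp {q : ℝ → H} {T t : ℝ} (hq : MemLp q 2 (timeMeasure T))
    (ht : t ∈ Icc 0 T) : IntervalIntegrable q volume 0 t := by
  rw [intervalIntegrable_iff_integrableOn_Ioo_of_le ht.1]
  exact integrable_of_memLp_time (memLp_mono_time hq ht.2)

lemma integral_norm_le (T : ℝ) (q : Lp H 2 (timeMeasure T)) :
    ∫ s in Ioo 0 T, ‖q s‖ ≤ (timeMeasure T univ ^ (1 / 2 : ℝ)).toReal * ‖q‖ := by
  have hq := Lp.memLp q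
  have h1 : ∫ s in Ioo 0 T, ‖q s‖ = (eLpNorm q 1 (timeMeasure T)).toReal := by
    rw [eLpNorm_one_eq_lintegral_enorm, integral_norm_eq_lintegral_enorm hq.1]
  rw [h1, Lp.norm_def, mul_comm, ← ENNReal.toReal_mul]
  have hfin : timeMeasure T univ ^ (1 / 2 : ℝ) ≠ ⊤ :=
    ENNReal.rpow_ne_top_of_nonneg (by norm_num) (measure_ne_top _ _)
  refine ENNReal.toReal_mono (ENNReal.mul_ne_top hq.2.ne hfin) ?_
  refine (eLpNorm_le_eLpNorm_mul_rpow_measure_univ (p := 1) (q := 2) (by norm_num) hq.1).trans ?_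
  norm_num

/-- The constant function `a` as an element of `L²(0, T; H)`. -/
abbrev constLp (T : ℝ) (a : H) : Lp H 2 (timeMeasure T) := Lp.const 2 (timeMeasure T) a

lemma coeFn_constLp (T : ℝ) (a : H) : constLp T a =ᵐ[timeMeasure T] fun _ => a :=
  Lp.coeFn_const ..

variable [InnerProductSpace ℝ H]

/-- The primitive of `q` that vanishes at `0`. For `q` in `L²(0, T; H)` it is used on `[0, T]` only:
outside, it depends on the representative of `q`. -/
def prim (q : ℝ → H) (t : ℝ) : H := ∫ s in (0)..t, q s

@[simp] lemma prim_zero (q : ℝ → H) : prim q 0 = 0 := intervalIntegral.integral_same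

lemma prim_eq_setIntegral (q : ℝ → H) {t : ℝ} (ht : 0 ≤ t) : prim q t = ∫ s in Ioo 0 t, q s := by
  rw [prim, intervalIntegral.integral_of_le ht, integral_Ioc_eq_integral_Ioo]

lemma prim_congr {p q : ℝ → H} {T t : ℝ} (h : p =ᵐ[timeMeasure T] q) (ht : t ∈ Icc 0 T) :
    prim p t = prim q t := by
  rw [prim_eq_setIntegral _ ht.1, prim_eq_setIntegral _ ht.1]
  exact integral_congr_ae
    (ae_mono (Measure.restrict_mono (Ioo_subset_Ioo_right ht.2) le_rfl) h)

lemma prim_add {p q : ℝ → H} {T t : ℝ} (hp : MemLp p 2 (timeMeasure T))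
    (hq : MemLp q 2 (timeMeasure T)) (ht : t ∈ Icc 0 T) :
    prim (fun s => p s + q s) t = prim p t + prim q t :=
  intervalIntegral.integral_add (intervalIntegrable_of_memLp hp ht)
    (intervalIntegrable_of_memLp hq ht)

lemma prim_sub {p q : ℝ → H} {T t : ℝ} (hp : MemLp p 2 (timeMeasure T))
    (hq : MemLp q 2 (timeMeasure T)) (ht : t ∈ Icc 0 T) :
    prim (fun s => p s - q s) t = prim p t - prim q t :=
  intervalIntegral.integral_sub (intervalIntegrable_of_memLp hp ht)
    (intervalIntegrable_of_memLp hq ht)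

lemma prim_smul (c : ℝ) (q : ℝ → H) (t : ℝ) : prim (fun s => c • q s) t = c • prim q t :=
  intervalIntegral.integral_smul c q

lemma continuousOn_prim {q : ℝ → H} {T : ℝ} (hT : 0 ≤ T) (hq : MemLp q 2 (timeMeasure T)) :
    ContinuousOn (prim q) (Icc 0 T) := by
  have := intervalIntegral.continuousOn_primitive_interval (f := q) (μ := volume) (a := 0) (b := T)
    (by
      rw [uIcc_of_le hT, integrableOn_Icc_iff_integrableOn_Ioo]
      exact integrable_of_memLp_time hq)
  rwa [uIcc_of_le hT] at this

lemma norm_prim_le {q : ℝ → H} {T t : ℝ} (hq : MemLp q 2 (timeMeasure T)) (ht : t ∈ Icc 0 T) :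
    ‖prim q t‖ ≤ ∫ s in Ioo 0 T, ‖q s‖ := by
  rw [prim_eq_setIntegral _ ht.1]
  refine (norm_integral_le_integral_norm _).trans ?_
  exact setIntegral_mono_set (integrable_of_memLp_time hq).norm (ae_of_all _ fun _ => norm_nonneg _)
    (Ioo_subset_Ioo_right ht.2).eventuallyLE

lemma prim_memLp {q : ℝ → H} {T : ℝ} (hT : 0 ≤ T) (hq : MemLp q 2 (timeMeasure T)) :
    MemLp (prim q) 2 (timeMeasure T) :=
  memLp_of_continuousOn (continuousOn_prim hT hq)

/-- The operator `q ↦ ∫₀ᵗ q` on `L²(0, T; H)`. -/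
def volterra (H : Type*) [NormedAddCommGroup H] [InnerProductSpace ℝ H] {T : ℝ} (hT : 0 ≤ T) :
    Lp H 2 (timeMeasure T) →L[ℝ] Lp H 2 (timeMeasure T) :=
  LinearMap.mkContinuous
    { toFun := fun q => (prim_memLp hT (Lp.memLp q)).toLp (prim q)
      map_add' := fun p q => by
        rw [← MemLp.toLp_add]
        refine MemLp.toLp_congr _ _ ?_
        filter_upwards [ae_restrict_mem measurableSet_Ioo] with t ht
        have ht' := Ioo_subset_Icc_self ht
        rw [prim_congr (Lp.coeFn_add p q) ht']
        exact prim_add (Lp.memLp p) (Lp.memLp q) ht'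
      map_smul' := fun c q => by
        rw [RingHom.id_apply, ← MemLp.toLp_const_smul]
        refine MemLp.toLp_congr _ _ ?_
        filter_upwards [ae_restrict_mem measurableSet_Ioo] with t ht
        rw [prim_congr (Lp.coeFn_smul c q) (Ioo_subset_Icc_self ht)]
        exact prim_smul c q t }
    (((timeMeasure T univ).toReal ^ (2 : ℝ≥0∞).toReal⁻¹) *
      (timeMeasure T univ ^ (1 / 2 : ℝ)).toReal)
    fun q => by
      rw [mul_assoc]
      refine Lp.norm_le_of_ae_bound (by positivity) ?_
      filter_upwards [ae_restrict_mem measurableSet_Ioo,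
        (prim_memLp hT (Lp.memLp q)).coeFn_toLp] with t ht hqt
      refine (congrArg norm hqt).le.trans ?_
      exact (norm_prim_le (Lp.memLp q) (Ioo_subset_Icc_self ht)).trans (integral_norm_le T q)

lemma coeFn_volterra {T : ℝ} (hT : 0 ≤ T) (q : Lp H 2 (timeMeasure T)) :
    volterra H hT q =ᵐ[timeMeasure T] prim q :=
  (prim_memLp hT (Lp.memLp q)).coeFn_toLp

/-- The operator `q ↦ ∫₀ᵗ q` from `L²(0, T; H)` to `H`, for a fixed `t`. -/
def primAt (H : Type*) [NormedAddCommGroup H] [InnerProductSpace ℝ H] {T t : ℝ}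
    (ht : t ∈ Icc 0 T) : Lp H 2 (timeMeasure T) →L[ℝ] H :=
  LinearMap.mkContinuous
    { toFun := fun q => prim q t
      map_add' := fun p q => by
        rw [prim_congr (Lp.coeFn_add p q) ht]
        exact prim_add (Lp.memLp p) (Lp.memLp q) ht
      map_smul' := fun c q => by
        rw [prim_congr (Lp.coeFn_smul c q) ht]
        exact prim_smul c q t }
    (timeMeasure T univ ^ (1 / 2 : ℝ)).toReal
    fun q => (norm_prim_le (Lp.memLp q) ht).trans (integral_norm_le T q)

@[simp] lemma primAt_apply {T t : ℝ} (ht : t ∈ Icc 0 T) (q : Lp H 2 (timeMeasure T)) :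
    primAt H ht q = prim q t := rfl

lemma coeFn_constLp_add_volterra {T : ℝ} (hT : 0 ≤ T) (a : H) (q : Lp H 2 (timeMeasure T)) :
    (constLp T a + volterra H hT q : Lp H 2 (timeMeasure T)) =ᵐ[timeMeasure T]
      fun t => a + prim q t := by
  filter_upwards [Lp.coeFn_add (constLp T a) (volterra H hT q), coeFn_constLp T a,
    coeFn_volterra hT q] with t h1 h2 h3
  rw [h1, Pi.add_apply, h2, h3]

lemma integral_inner_eq {T : ℝ} {p q : Lp H 2 (timeMeasure T)} {p' q' : ℝ → H}
    (hp : p =ᵐ[timeMeasure T] p') (hq : q =ᵐ[timeMeasure T] q') :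
    ∫ t in Ioo 0 T, ⟪p' t, q' t⟫_ℝ = ⟪p, q⟫_ℝ := by
  rw [L2.inner_def]
  refine integral_congr_ae ?_
  filter_upwards [hp, hq] with t h1 h2
  rw [h1, h2]

lemma integrable_inner_of_memLp {p q : ℝ → H} {T : ℝ} (hp : MemLp p 2 (timeMeasure T))
    (hq : MemLp q 2 (timeMeasure T)) : Integrable (fun t => ⟪p t, q t⟫_ℝ) (timeMeasure T) := by
  refine (L2.integrable_inner (𝕜 := ℝ) (hp.toLp p) (hq.toLp q)).congr ?_
  filter_upwards [hp.coeFn_toLp, hq.coeFn_toLp] with t h1 h2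
  rw [h1, h2]

variable [CompleteSpace H]

lemma inner_prim_of_continuous {T : ℝ} (hT : 0 ≤ T) {p q : ℝ → H} (hp : Continuous p)
    (hq : Continuous q) (a b : H) :
    ⟪a + prim p T, b + prim q T⟫_ℝ = ⟪a, b⟫_ℝ +
      ((∫ t in Ioo 0 T, ⟪a + prim p t, q t⟫_ℝ) + ∫ t in Ioo 0 T, ⟪p t, b + prim q t⟫_ℝ) := by
  have hd : ∀ {p : ℝ → H}, Continuous p → ∀ (a : H) t,
      HasDerivAt (fun t => a + prim p t) (p t) t := fun hp a t =>
    (intervalIntegral.integral_hasDerivAt_right (hp.intervalIntegrable _ _)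
      (hp.stronglyMeasurableAtFilter _ _) hp.continuousAt).const_add a
  have hc : ∀ {p : ℝ → H}, Continuous p → ∀ (a : H), Continuous fun t => a + prim p t :=
    fun hp a => continuous_iff_continuousAt.2 fun t => (hd hp a t).continuousAt
  have h1 : Continuous fun t => ⟪a + prim p t, q t⟫_ℝ := (hc hp a).inner hq
  have h2 : Continuous fun t => ⟪p t, b + prim q t⟫_ℝ := hp.inner (hc hq b)
  have h := intervalIntegral.integral_eq_sub_of_hasDerivAt (a := 0) (b := T)
    (fun t _ => (hd hp a t).inner ℝ (hd hq b t)) ((h1.add h2).intervalIntegrable _ _)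
  rw [intervalIntegral.integral_add (h1.intervalIntegrable _ _) (h2.intervalIntegrable _ _),
    intervalIntegral.integral_of_le hT, intervalIntegral.integral_of_le hT,
    integral_Ioc_eq_integral_Ioo, integral_Ioc_eq_integral_Ioo] at h
  simp only [prim_zero, add_zero] at h
  linarith

/-- The product rule `(y, z)' = (y, z') + (y', z)`, integrated over `(0, T)`, for functions `y`, `z`
with derivatives in `L²(0, T; H)`. Both sides are continuous in the derivatives, which may
therefore be taken continuous in time. -/
lemma inner_prim {T : ℝ} (hT : 0 ≤ T) {p q : ℝ → H} (hp : MemLp p 2 (timeMeasure T))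
    (hq : MemLp q 2 (timeMeasure T)) (a b : H) :
    ⟪a + prim p T, b + prim q T⟫_ℝ = ⟪a, b⟫_ℝ +
      ((∫ t in Ioo 0 T, ⟪a + prim p t, q t⟫_ℝ) + ∫ t in Ioo 0 T, ⟪p t, b + prim q t⟫_ℝ) := by
  have hTT : T ∈ Icc 0 T := ⟨hT, le_rfl⟩
  have key : ∀ P Q : Lp H 2 (timeMeasure T),
      ⟪a + primAt H hTT P, b + primAt H hTT Q⟫_ℝ = ⟪a, b⟫_ℝ +
        (⟪constLp T a + volterra H hT P, Q⟫_ℝ + ⟪P, constLp T b + volterra H hT Q⟫_ℝ) := by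
    intro P Q
    have hd := BoundedContinuousFunction.toLp_denseRange (α := ℝ) H (timeMeasure T) ℝ
      (p := 2) (by norm_num)
    refine hd.induction_on₂ (isClosed_eq (by fun_prop) (by fun_prop)) (fun f g => ?_) P Q
    have hf := BoundedContinuousFunction.coeFn_toLp (p := 2) (timeMeasure T) ℝ f
    have hg := BoundedContinuousFunction.coeFn_toLp (p := 2) (timeMeasure T) ℝ g
    have := inner_prim_of_continuous hT f.continuous g.continuous a b
    rw [primAt_apply, primAt_apply, prim_congr hf hTT, prim_congr hg hTT, this]
    congr 2
    · refine integral_inner_eq ?_ hg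
      filter_upwards [coeFn_constLp_add_volterra hT a
        (BoundedContinuousFunction.toLp 2 (timeMeasure T) ℝ f),
        ae_restrict_mem measurableSet_Ioo] with t h ht
      rw [h, prim_congr hf (Ioo_subset_Icc_self ht)]
    · refine integral_inner_eq hf ?_
      filter_upwards [coeFn_constLp_add_volterra hT b
        (BoundedContinuousFunction.toLp 2 (timeMeasure T) ℝ g),
        ae_restrict_mem measurableSet_Ioo] with t h ht
      rw [h, prim_congr hg (Ioo_subset_Icc_self ht)]
  have h := key (hp.toLp p) (hq.toLp q)
  rw [primAt_apply, primAt_apply, prim_congr hp.coeFn_toLp hTT,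
    prim_congr hq.coeFn_toLp hTT] at h
  rw [h]
  congr 2
  · symm
    refine integral_inner_eq ?_ hq.coeFn_toLp
    filter_upwards [coeFn_constLp_add_volterra hT a (hp.toLp p),
      ae_restrict_mem measurableSet_Ioo] with t h ht
    rw [h, prim_congr hp.coeFn_toLp (Ioo_subset_Icc_self ht)]
  · symm
    refine integral_inner_eq hp.coeFn_toLp ?_
    filter_upwards [coeFn_constLp_add_volterra hT b (hq.toLp q),
      ae_restrict_mem measurableSet_Ioo] with t h ht
    rw [h, prim_congr hq.coeFn_toLp (Ioo_subset_Icc_self ht)]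

lemma prim_clm {F : Type*} [NormedAddCommGroup F] [InnerProductSpace ℝ F] [CompleteSpace F]
    (S : H →L[ℝ] F) {q : ℝ → H} {T t : ℝ} (hq : MemLp q 2 (timeMeasure T)) (ht : t ∈ Icc 0 T) :
    prim (fun s => S (q s)) t = S (prim q t) :=
  S.intervalIntegral_comp_comm (intervalIntegrable_of_memLp hq ht)

/-- The energy identity for the quadratic form of a bounded self-adjoint operator. -/
lemma inner_clm_prim_self {S : H →L[ℝ] H} (hS : ∀ x y, ⟪S x, y⟫_ℝ = ⟪x, S y⟫_ℝ) {T t : ℝ}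
    {q : ℝ → H} (hq : MemLp q 2 (timeMeasure T)) (ht : t ∈ Icc 0 T) (a : H) :
    ⟪S (a + prim q t), a + prim q t⟫_ℝ = ⟪S a, a⟫_ℝ +
      2 * ∫ s in Ioo 0 t, ⟪S (a + prim q s), q s⟫_ℝ := by
  have hq' := memLp_mono_time hq ht.2
  have h := inner_prim ht.1 (hq'.continuousLinearMap_comp S) hq' (S a) a
  have h1 : ∫ s in Ioo 0 t, ⟪S a + prim (fun s => S (q s)) s, q s⟫_ℝ =
      ∫ s in Ioo 0 t, ⟪S (a + prim q s), q s⟫_ℝ := by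
    refine setIntegral_congr_fun measurableSet_Ioo fun s hs => ?_
    rw [prim_clm S hq' (Ioo_subset_Icc_self hs), map_add]
  have h2 : ∫ s in Ioo 0 t, ⟪S (q s), a + prim q s⟫_ℝ =
      ∫ s in Ioo 0 t, ⟪S (a + prim q s), q s⟫_ℝ := by
    refine setIntegral_congr_fun measurableSet_Ioo fun s hs => ?_
    rw [real_inner_comm, hS]
  rw [h1, h2, prim_clm S hq' ⟨ht.1, le_rfl⟩, ← map_add] at h
  rw [h]
  ring

/-- Integration by parts against a test function. -/
lemma integral_deriv_smul_prim {T : ℝ} (hT : 0 < T) {q : ℝ → H} (hq : MemLp q 2 (timeMeasure T))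
    (a : H) {φ : ℝ → ℝ} (hφ : ContDiff ℝ ∞ φ) (hs : tsupport φ ⊆ Ioo 0 T) :
    ∫ t in Ioo 0 T, deriv φ t • (a + prim q t) = -∫ t in Ioo 0 T, φ t • q t := by
  have hcd : Continuous (deriv φ) := hφ.continuous_deriv (by simp)
  have hz : ∀ t ∉ Ioo 0 T, φ t = 0 := fun t ht =>
    image_eq_zero_of_notMem_tsupport fun h => ht (hs h)
  have hz0 := hz 0 (by simp)
  have i1 : Integrable (fun t => deriv φ t • (a + prim q t)) (timeMeasure T) :=
    integrable_of_memLp_time (memLp_of_continuousOn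
      (hcd.continuousOn.smul (continuousOn_const.add (continuousOn_prim hT.le hq))))
  have i2 : Integrable (fun t => φ t • q t) (timeMeasure T) :=
    integrable_smul_of_memLp hq hφ.continuous
      (isCompact_Icc.of_isClosed_subset (isClosed_tsupport φ) (hs.trans Ioo_subset_Icc_self))
  refine ext_inner_left ℝ fun h => ?_
  rw [inner_neg_right, ← integral_inner i1, ← integral_inner i2]
  have hm : MemLp (fun t => deriv φ t • h) 2 (timeMeasure T) :=
    memLp_of_continuousOn (hcd.smul continuous_const).continuousOn
  have hpr : ∀ t, prim (fun t => deriv φ t • h) t = φ t • h := by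
    intro t
    rw [prim, intervalIntegral.integral_smul_const, intervalIntegral.integral_deriv_eq_sub
      (fun x _ => hφ.differentiable (by simp) x) (hcd.intervalIntegrable _ _), hz0, sub_zero]
  have key := inner_prim hT.le hm hq 0 a
  simp only [hpr, zero_add, hz T (by simp), zero_smul, inner_zero_left, real_inner_smul_left]
    at key
  simp only [real_inner_smul_right]
  linarith

end Time

section DuBoisReymond

variable {H : Type*} [NormedAddCommGroup H] [InnerProductSpace ℝ H] [CompleteSpace H]

/-- A function on `(0, T)` whose distributional derivative vanishes is constant (the lemma of
du Bois-Reymond): a test function `ψ` minus `(∫ ψ) φ₀`, where `∫ φ₀ = 1`, is the derivative of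
a test function. -/
lemma ae_eq_const_of_integral_deriv_smul_eq_zero {T : ℝ} (hT : 0 < T) {y : ℝ → H}
    (hy : MemLp y 2 (timeMeasure T))
    (h : ∀ φ : ℝ → ℝ, ContDiff ℝ ∞ φ → HasCompactSupport φ → tsupport φ ⊆ Ioo 0 T →
      ∫ t in Ioo 0 T, deriv φ t • y t = 0) :
    ∃ a : H, ∀ᵐ t ∂timeMeasure T, y t = a := by
  let B : ContDiffBump (T / 2) := ⟨T / 8, T / 4, by linarith, by linarith⟩
  set φ₀ : ℝ → ℝ := B.normed volume with hφ₀
  have h0d : ContDiff ℝ ∞ φ₀ := B.contDiff_normed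
  have h0c : HasCompactSupport φ₀ := B.hasCompactSupport_normed
  have h0i : ∫ t, φ₀ t = 1 := B.integral_normed
  have h0t : tsupport φ₀ = Metric.closedBall (T / 2) (T / 4) := B.tsupport_normed_eq
  have h0s : tsupport φ₀ ⊆ Ioo 0 T := by
    rw [h0t, Real.closedBall_eq_Icc]
    exact Icc_subset_Ioo (by linarith) (by linarith)
  set a : H := ∫ t in Ioo 0 T, φ₀ t • y t with ha
  have hya : MemLp (fun t => y t - a) 2 (timeMeasure T) := hy.sub (memLp_const a)
  refine ⟨a, ?_⟩
  have key := isOpen_Ioo.ae_eq_zero_of_integral_contDiff_smul_eq_zero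
    (U := Ioo 0 T) (f := fun t => y t - a) (μ := timeMeasure T)
    ((integrable_of_memLp_time hya).locallyIntegrable.locallyIntegrableOn _) (by
      intro ψ hψ hψc hψs
      set I : ℝ := ∫ t, ψ t with hI
      set χ : ℝ → ℝ := fun t => ψ t - I * φ₀ t with hχ
      have hχd : ContDiff ℝ ∞ χ := hψ.sub (contDiff_const.mul h0d)
      obtain ⟨c, hcK, hcl⟩ := (hψc.isCompact.union h0c.isCompact).exists_isLeast
        ⟨T / 2, Or.inr (by rw [h0t]; exact Metric.mem_closedBall_self (by linarith))⟩
      obtain ⟨d, hdK, hdl⟩ := (hψc.isCompact.union h0c.isCompact).exists_isGreatest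
        ⟨T / 2, Or.inr (by rw [h0t]; exact Metric.mem_closedBall_self (by linarith))⟩
      have hc := union_subset hψs h0s hcK
      have hd := union_subset hψs h0s hdK
      have hχz : ∀ t, t ∉ Icc c d → χ t = 0 := by
        intro t ht
        have h1 : t ∉ tsupport ψ := fun hh => ht ⟨hcl (Or.inl hh), hdl (Or.inl hh)⟩
        have h2 : t ∉ tsupport φ₀ := fun hh => ht ⟨hcl (Or.inr hh), hdl (Or.inr hh)⟩
        simp [hχ, image_eq_zero_of_notMem_tsupport h1, image_eq_zero_of_notMem_tsupport h2]
      have hχi : ∫ t in (0)..T, χ t = 0 := by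
        rw [intervalIntegral.integral_of_le hT.le, setIntegral_eq_integral_of_forall_compl_eq_zero]
        · rw [hχ, integral_sub (hψ.continuous.integrable_of_hasCompactSupport hψc)
            ((h0d.continuous.integrable_of_hasCompactSupport h0c).const_mul I),
            integral_const_mul, h0i, mul_one, sub_self]
        · exact fun t ht => hχz t fun hh => ht ⟨hc.1.trans_le hh.1, hh.2.trans hd.2.le⟩
      have hder : ∀ t, HasDerivAt (fun t => ∫ s in (0)..t, χ s) (χ t) t := fun t =>
        intervalIntegral.integral_hasDerivAt_right (hχd.continuous.intervalIntegrable _ _)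
          (hχd.continuous.stronglyMeasurableAtFilter _ _) hχd.continuous.continuousAt
      have hφd : deriv (fun t => ∫ s in (0)..t, χ s) = χ := funext fun t => (hder t).deriv
      have hφz : ∀ t, t ∉ Icc c d → ∫ s in (0)..t, χ s = 0 := by
        intro t ht
        rcases lt_or_ge t c with htc | htc
        · refine intervalIntegral.integral_zero_ae (ae_of_all _ fun s hs => hχz s fun hh => ?_)
          have := hs.2.trans_lt (max_lt hc.1 htc)
          exact absurd hh.1 (not_le.2 this)
        · have htd : d < t := by
            by_contra! hle
            exact ht ⟨htc, hle⟩
          rw [← intervalIntegral.integral_add_adjacent_intervals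
            (hχd.continuous.intervalIntegrable 0 T) (hχd.continuous.intervalIntegrable T t), hχi,
            zero_add]
          refine intervalIntegral.integral_zero_ae (ae_of_all _ fun s hs => hχz s fun hh => ?_)
          have := (lt_min hd.2 htd).trans hs.1
          exact absurd hh.2 (not_le.2 this)
      have hφs : tsupport (fun t => ∫ s in (0)..t, χ s) ⊆ Icc c d :=
        closure_minimal (fun t ht => by
          by_contra hh
          exact ht (hφz t hh)) isClosed_Icc
      have h1 := h (fun t => ∫ s in (0)..t, χ s)
        (contDiff_infty_iff_deriv.2 ⟨fun t => (hder t).differentiableAt, by rwa [hφd]⟩)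
        (isCompact_Icc.of_isClosed_subset (isClosed_tsupport _) hφs)
        (hφs.trans (Icc_subset_Ioo hc.1 hd.2))
      rw [hφd] at h1
      have h2 : ∫ t in Ioo 0 T, χ t • y t = (∫ t in Ioo 0 T, ψ t • y t) - I • a := by
        have hi : Integrable (fun t => I • φ₀ t • y t) (timeMeasure T) :=
          (integrable_smul_of_memLp hy h0d.continuous h0c).smul I
        rw [ha, ← integral_smul,
          ← integral_sub (integrable_smul_of_memLp hy hψ.continuous hψc) hi]
        refine integral_congr_ae (ae_of_all _ fun t => ?_)
        simp only [hχ, sub_smul, mul_smul]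
      have h3 : ∫ t in Ioo 0 T, ψ t • a = I • a := by
        rw [integral_smul_const, hI, setIntegral_eq_integral_of_forall_compl_eq_zero]
        exact fun t ht => image_eq_zero_of_notMem_tsupport fun hh => ht (hψs hh)
      simp only [smul_sub]
      rw [integral_sub (integrable_smul_of_memLp hy hψ.continuous hψc)
        (integrable_smul_of_memLp (memLp_const a) hψ.continuous hψc), h3, ← h2, h1])
  filter_upwards [key, ae_restrict_mem measurableSet_Ioo] with t ht hmem
  exact sub_eq_zero.1 (ht hmem)

end DuBoisReymond

/-! ### Operators acting pointwise in time -/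

section Lift

variable {H F : Type*} [NormedAddCommGroup H] [InnerProductSpace ℝ H]
  [NormedAddCommGroup F] [InnerProductSpace ℝ F]

/-- The operator on `L²(0, T; H)` that applies `S` at every time. -/
abbrev lift (T : ℝ) (S : H →L[ℝ] F) : Lp H 2 (timeMeasure T) →L[ℝ] Lp F 2 (timeMeasure T) :=
  S.compLpL 2 (timeMeasure T)

lemma coeFn_lift (T : ℝ) (S : H →L[ℝ] F) (q : Lp H 2 (timeMeasure T)) :
    lift T S q =ᵐ[timeMeasure T] fun t => S (q t) := S.coeFn_compLpL q

lemma lift_symm {S : H →L[ℝ] H} (hS : ∀ x y, ⟪S x, y⟫_ℝ = ⟪x, S y⟫_ℝ) {T : ℝ}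
    (p q : Lp H 2 (timeMeasure T)) : ⟪lift T S p, q⟫_ℝ = ⟪p, lift T S q⟫_ℝ := by
  rw [L2.inner_def, L2.inner_def]
  refine integral_congr_ae ?_
  filter_upwards [coeFn_lift T S p, coeFn_lift T S q] with t h1 h2
  rw [h1, h2, hS]

lemma lift_nonneg {S : H →L[ℝ] H} (hS : ∀ x, 0 ≤ ⟪S x, x⟫_ℝ) {T : ℝ}
    (q : Lp H 2 (timeMeasure T)) : 0 ≤ ⟪lift T S q, q⟫_ℝ := by
  rw [L2.inner_def]
  refine integral_nonneg_of_ae ?_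
  filter_upwards [coeFn_lift T S q] with t h1
  rw [h1]
  exact hS _

lemma lift_injective {S : H →L[ℝ] F} (hS : Function.Injective S) (T : ℝ) :
    Function.Injective (lift T S) := by
  intro p q h
  refine Lp.ext ?_
  filter_upwards [coeFn_lift T S p, coeFn_lift T S q] with t h1 h2
  exact hS (by rw [← h1, ← h2, h])

lemma IsRegularizer.lift [CompleteSpace H] {J : H →L[ℝ] H} {R : ℕ → H →L[ℝ] H}
    (hR : IsRegularizer J R) (T : ℝ) :
    IsRegularizer (lift T J) fun n => MixedStokes.lift T (R n) where
  right n x := by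
    refine Lp.ext ?_
    filter_upwards [Lp.coeFn_add (MixedStokes.lift T J (MixedStokes.lift T (R n) x))
      (eps n • MixedStokes.lift T (R n) x), Lp.coeFn_smul (eps n) (MixedStokes.lift T (R n) x),
      coeFn_lift T J (MixedStokes.lift T (R n) x), coeFn_lift T (R n) x] with t h1 h2 h3 h4
    rw [h1, Pi.add_apply, h2, Pi.smul_apply, h3, h4, hR.right]
  left n x := by
    refine Lp.ext ?_
    filter_upwards [Lp.coeFn_add (MixedStokes.lift T (R n) (MixedStokes.lift T J x))
      (eps n • MixedStokes.lift T (R n) x), Lp.coeFn_smul (eps n) (MixedStokes.lift T (R n) x),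
      coeFn_lift T (R n) (MixedStokes.lift T J x), coeFn_lift T J x,
      coeFn_lift T (R n) x] with t h1 h2 h3 h4 h5
    rw [h1, Pi.add_apply, h2, Pi.smul_apply, h3, h4, h5, hR.left]

lemma IsRegularizer.comm [CompleteSpace H] {J : H →L[ℝ] H} {R : ℕ → H →L[ℝ] H}
    (hR : IsRegularizer J R) (n : ℕ) (x : H) : R n (J x) = J (R n x) :=
  add_right_cancel ((hR.left n x).trans (hR.right n x).symm)

lemma lift_volterra [CompleteSpace H] [CompleteSpace F] (S : H →L[ℝ] F) {T : ℝ} (hT : 0 ≤ T)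
    (q : Lp H 2 (timeMeasure T)) :
    lift T S (volterra H hT q) = volterra F hT (lift T S q) := by
  refine Lp.ext ?_
  filter_upwards [coeFn_lift T S (volterra H hT q), coeFn_volterra hT q,
    coeFn_volterra hT (lift T S q), ae_restrict_mem measurableSet_Ioo] with t h1 h2 h3 ht
  have ht' := Ioo_subset_Icc_self ht
  rw [h1, h2, h3, prim_congr (coeFn_lift T S q) ht', prim_clm S (Lp.memLp q) ht']

lemma lift_constLp (S : H →L[ℝ] F) (T : ℝ) (a : H) : lift T S (constLp T a) = constLp T (S a) := by
  refine Lp.ext ?_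
  filter_upwards [coeFn_lift T S (constLp T a), coeFn_constLp T a, coeFn_constLp T (S a)]
    with t h1 h2 h3
  rw [h1, h2, h3]

lemma lift_one_sub (T : ℝ) (J : H →L[ℝ] H) (q : Lp H 2 (timeMeasure T)) :
    lift T (1 - J) q = q - lift T J q := by
  refine Lp.ext ?_
  filter_upwards [coeFn_lift T (1 - J) q, coeFn_lift T J q, Lp.coeFn_sub q (lift T J q)]
    with t h1 h2 h3
  rw [h1, h3, Pi.sub_apply, h2]
  rfl

lemma lift_add_smul (T : ℝ) (J : H →L[ℝ] H) (ε : ℝ) (q : Lp H 2 (timeMeasure T)) :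
    lift T (J + ε • 1) q = lift T J q + ε • q := by
  refine Lp.ext ?_
  filter_upwards [coeFn_lift T (J + ε • 1) q, coeFn_lift T J q,
    Lp.coeFn_add (lift T J q) (ε • q), Lp.coeFn_smul ε q] with t h1 h2 h3 h4
  rw [h1, h3, Pi.add_apply, h2, h4]
  rfl

lemma lift_comp (T : ℝ) (S R : H →L[ℝ] H) (q : Lp H 2 (timeMeasure T)) :
    lift T (S ∘L R) q = lift T S (lift T R q) := by
  refine Lp.ext ?_
  filter_upwards [coeFn_lift T (S ∘L R) q, coeFn_lift T R q, coeFn_lift T S (lift T R q)]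
    with t h1 h2 h3
  rw [h1, h3, h2]
  rfl

/-- The restriction `L²(0, T; H) → L²(0, t; H)` for `t ≤ T`. -/
def restrictTime (H : Type*) [NormedAddCommGroup H] [InnerProductSpace ℝ H] {T t : ℝ}
    (ht : t ≤ T) : Lp H 2 (timeMeasure T) →L[ℝ] Lp H 2 (timeMeasure t) :=
  LinearMap.mkContinuous
    { toFun := fun q => (memLp_mono_time (Lp.memLp q) ht).toLp q
      map_add' := fun p q => by
        rw [← MemLp.toLp_add]
        exact MemLp.toLp_congr _ _ (ae_mono (Measure.restrict_mono (Ioo_subset_Ioo_right ht) le_rfl)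
          (Lp.coeFn_add p q))
      map_smul' := fun c q => by
        rw [RingHom.id_apply, ← MemLp.toLp_const_smul]
        exact MemLp.toLp_congr _ _ (ae_mono (Measure.restrict_mono (Ioo_subset_Ioo_right ht) le_rfl)
          (Lp.coeFn_smul c q)) }
    1 fun q => by
      rw [one_mul]
      refine (Lp.norm_toLp _ (memLp_mono_time (Lp.memLp q) ht)).le.trans ?_
      rw [Lp.norm_def]
      exact ENNReal.toReal_mono (Lp.memLp q).2.ne
        (eLpNorm_mono_measure _ (Measure.restrict_mono (Ioo_subset_Ioo_right ht) le_rfl))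

lemma norm_restrictTime_le {T t : ℝ} (ht : t ≤ T) (q : Lp H 2 (timeMeasure T)) :
    ‖restrictTime H ht q‖ ≤ ‖q‖ := by
  have := (restrictTime H ht).le_of_opNorm_le (LinearMap.mkContinuous_norm_le _ zero_le_one _) q
  rwa [one_mul] at this

lemma integral_inner_eq_restrictTime {T t : ℝ} (ht : t ≤ T) {p q : Lp H 2 (timeMeasure T)}
    {p' q' : ℝ → H} (hp : p =ᵐ[timeMeasure T] p') (hq : q =ᵐ[timeMeasure T] q') :
    ∫ s in Ioo 0 t, ⟪p' s, q' s⟫_ℝ = ⟪restrictTime H ht p, restrictTime H ht q⟫_ℝ := by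
  have hm : ∀ {p : Lp H 2 (timeMeasure T)} {p' : ℝ → H}, p =ᵐ[timeMeasure T] p' →
      restrictTime H ht p =ᵐ[timeMeasure t] p' := fun {p} {p'} h =>
    (memLp_mono_time (Lp.memLp p) ht).coeFn_toLp.trans
      (ae_mono (Measure.restrict_mono (Ioo_subset_Ioo_right ht) le_rfl) h)
  exact integral_inner_eq (hm hp) (hm hq)

end Lift

/-! ### The resolvent of a form -/

section Form

variable {V H : Type*} [NormedAddCommGroup V] [InnerProductSpace ℝ V] [CompleteSpace V]
  [NormedAddCommGroup H] [InnerProductSpace ℝ H] [CompleteSpace H]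

/-- The operator `J = j j*` on `H`. If the scalar product of `V` is `a(v, w) + (j v, j w)` for
a form `a`, and `A` is the operator in `H` given by `a`, then `J = (1 + A)⁻¹`. -/
def formResolvent (j : V →L[ℝ] H) : H →L[ℝ] H := j ∘L j.adjoint

lemma formResolvent_apply (j : V →L[ℝ] H) (x : H) : formResolvent j x = j (j.adjoint x) := rfl

lemma inner_formResolvent (j : V →L[ℝ] H) (x y : H) :
    ⟪formResolvent j x, y⟫_ℝ = ⟪j.adjoint x, j.adjoint y⟫_ℝ := by
  rw [formResolvent_apply, ContinuousLinearMap.adjoint_inner_right]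

lemma inner_formResolvent_self (j : V →L[ℝ] H) (x : H) :
    ⟪formResolvent j x, x⟫_ℝ = ‖j.adjoint x‖ ^ 2 := by
  rw [inner_formResolvent, real_inner_self_eq_norm_sq]

lemma formResolvent_nonneg (j : V →L[ℝ] H) (x : H) : 0 ≤ ⟪formResolvent j x, x⟫_ℝ := by
  rw [inner_formResolvent_self]
  positivity

lemma formResolvent_symm (j : V →L[ℝ] H) (x y : H) :
    ⟪formResolvent j x, y⟫_ℝ = ⟪x, formResolvent j y⟫_ℝ := by
  rw [inner_formResolvent, ← inner_formResolvent j y x |>.trans (real_inner_comm _ _),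
    real_inner_comm]

lemma formResolvent_injective {j : V →L[ℝ] H} (hd : DenseRange j) :
    Function.Injective (formResolvent j) := by
  rw [injective_iff_map_eq_zero]
  intro x hx
  have h1 : j.adjoint x = 0 := by
    have := inner_formResolvent_self j x
    rw [hx, inner_zero_left] at this
    simpa using this.symm
  refine hd.eq_zero_of_inner_left ℝ fun v => ?_
  rw [← ContinuousLinearMap.adjoint_inner_left, h1, inner_zero_left]

lemma norm_adjoint_le {j : V →L[ℝ] H} (hj : ∀ v, ‖j v‖ ≤ ‖v‖) (x : H) : ‖j.adjoint x‖ ≤ ‖x‖ := by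
  have h1 : ‖j.adjoint‖ ≤ 1 := by
    rw [LinearIsometryEquiv.norm_map]
    exact j.opNorm_le_bound zero_le_one fun v => by rw [one_mul]; exact hj v
  simpa using j.adjoint.le_of_opNorm_le h1 x

lemma formResolvent_complement_nonneg {j : V →L[ℝ] H} (hj : ∀ v, ‖j v‖ ≤ ‖v‖) (x : H) :
    0 ≤ ⟪x - formResolvent j x, x⟫_ℝ := by
  rw [inner_sub_left, inner_formResolvent_self, real_inner_self_eq_norm_sq]
  have := norm_adjoint_le hj x
  have h0 := norm_nonneg (j.adjoint x)
  nlinarith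

lemma inner_lift_formResolvent_le {j : V →L[ℝ] H} (hj : ∀ v, ‖j v‖ ≤ ‖v‖) {T : ℝ}
    (q : Lp H 2 (timeMeasure T)) : ⟪lift T (formResolvent j) q, q⟫_ℝ ≤ ‖q‖ ^ 2 := by
  rw [← real_inner_self_eq_norm_sq, L2.inner_def, L2.inner_def]
  refine integral_mono_ae (L2.integrable_inner (𝕜 := ℝ) _ _) (L2.integrable_inner (𝕜 := ℝ) _ _) ?_
  filter_upwards [coeFn_lift T (formResolvent j) q] with t h
  simp only [h]
  have := formResolvent_complement_nonneg hj (q t)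
  rw [inner_sub_left] at this
  linarith

/-! ### Continuity in time and the energy identity -/

/-- If `d(t) = a + ∫₀ᵗ q`, then `sup ‖j* d(t)‖²` is controlled by the norms of `d` and of `J d'` in
`L²(0, T; H)`: the derivative of `‖j* d‖² = (J d, d)` is `2 (d, J d')`. -/
lemma norm_adjoint_prim_sq_le {j : V →L[ℝ] H} (hj : ∀ v, ‖j v‖ ≤ ‖v‖) {T : ℝ}
    (q δ : Lp H 2 (timeMeasure T)) (a : H) (hδ : δ =ᵐ[timeMeasure T] fun t => a + prim q t)
    {t : ℝ} (ht : t ∈ Icc 0 T) :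
    T * ‖j.adjoint (a + prim q t)‖ ^ 2 ≤
      ‖δ‖ ^ 2 + 4 * T * (‖δ‖ * ‖lift T (formResolvent j) q‖) := by
  set J := formResolvent j
  set g := ‖δ‖ * ‖lift T J q‖ with hg
  have hT : 0 ≤ T := ht.1.trans ht.2
  have hF : ∀ s ∈ Icc 0 T, |‖j.adjoint (a + prim q s)‖ ^ 2 - ‖j.adjoint a‖ ^ 2| ≤ 2 * g := by
    intro s hs
    have h1 := inner_clm_prim_self (formResolvent_symm j) (Lp.memLp q) hs a
    have h2 : ∫ r in Ioo 0 s, ⟪J (a + prim q r), q r⟫_ℝ =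
        ⟪restrictTime H hs.2 δ, restrictTime H hs.2 (lift T J q)⟫_ℝ := by
      rw [← integral_inner_eq_restrictTime hs.2 hδ (coeFn_lift T J q)]
      simp only [J, formResolvent_symm]
    rw [h2, inner_formResolvent_self, inner_formResolvent_self] at h1
    rw [h1, add_sub_cancel_left, abs_mul, abs_two, hg]
    have h3 := abs_real_inner_le_norm (restrictTime H hs.2 δ) (restrictTime H hs.2 (lift T J q))
    have h4 := mul_le_mul (norm_restrictTime_le hs.2 δ) (norm_restrictTime_le hs.2 (lift T J q))
      (norm_nonneg _) (norm_nonneg _)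
    linarith
  have hle : ∀ s ∈ Icc 0 T,
      ‖j.adjoint (a + prim q t)‖ ^ 2 - 4 * g ≤ ‖j.adjoint (a + prim q s)‖ ^ 2 := by
    intro s hs
    have h1 := abs_le.1 (hF t ht)
    have h2 := abs_le.1 (hF s hs)
    linarith [h1.2, h2.1]
  -- There is no bound on `j* a`, so the value at `t` is compared with the mean over `(0, T)`.
  have hint : ∫ s in Ioo 0 T, ‖j.adjoint (a + prim q s)‖ ^ 2 = ⟪lift T J δ, δ⟫_ℝ := by
    rw [← integral_inner_eq (p := lift T J δ) (p' := fun s => J (a + prim q s)) ?_ hδ]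
    · simp only [J, inner_formResolvent_self]
    · filter_upwards [coeFn_lift T J δ, hδ] with s h1 h2
      rw [h1, h2]
  have hcont : ContinuousOn (fun s => ‖j.adjoint (a + prim q s)‖ ^ 2) (Icc 0 T) :=
    ((j.adjoint.continuous.comp_continuousOn
      (continuousOn_const.add (continuousOn_prim hT (Lp.memLp q)))).norm).pow 2
  have h1 : ∫ _ in Ioo 0 T, (‖j.adjoint (a + prim q t)‖ ^ 2 - 4 * g) ≤
      ∫ s in Ioo 0 T, ‖j.adjoint (a + prim q s)‖ ^ 2 := by
    refine setIntegral_mono_on (integrable_const _) ?_ measurableSet_Ioo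
      fun s hs => hle s (Ioo_subset_Icc_self hs)
    exact integrable_of_memLp_time (memLp_of_continuousOn hcont)
  rw [hint, setIntegral_const, smul_eq_mul, Real.volume_real_Ioo_of_le hT, sub_zero] at h1
  have h2 := inner_lift_formResolvent_le hj δ
  linarith

/-- Let `z(t) = a + ∫₀ᵗ w` and `z = J p` with `p`, `w` in `L²(0, T; H)`. Then `j* p` is represented
by a continuous `V`-valued function `U`, which satisfies the energy identity. The functions
`j* (J + ε)⁻¹ z` are continuous in time, and by `norm_adjoint_prim_sq_le` they converge uniformly
to `U`. -/
theorem exists_continuous_representative {j : V →L[ℝ] H} (hj : ∀ v, ‖j v‖ ≤ ‖v‖)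
    (hd : DenseRange j) {T : ℝ} (hT : 0 < T) (p w : Lp H 2 (timeMeasure T)) (a : H)
    (hz : ∀ᵐ t ∂timeMeasure T, formResolvent j (p t) = a + prim w t) :
    ∃ U : ℝ → V, ContinuousOn U (Icc 0 T) ∧ (∀ᵐ t ∂timeMeasure T, U t = j.adjoint (p t)) ∧
      (∀ t ∈ Icc 0 T, j (U t) = a + prim w t) ∧
      ∀ t ∈ Icc 0 T, ‖U t‖ ^ 2 - ‖j (U t)‖ ^ 2 = ‖U 0‖ ^ 2 - ‖j (U 0)‖ ^ 2 +
        2 * ∫ s in Ioo 0 t, ⟪p s - formResolvent j (p s), w s⟫_ℝ := by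
  set J := formResolvent j with hJ
  obtain ⟨R, hR⟩ := exists_regularizer J (formResolvent_nonneg j)
  set z : ℝ → H := fun t => a + prim w t with hzdef
  have hconv : ∀ x : Lp H 2 (timeMeasure T),
      Tendsto (fun n => lift T J (lift T (R n) x)) atTop (𝓝 x) := fun x =>
    (hR.lift T).tendsto (lift_symm (formResolvent_symm j)) (lift_nonneg (formResolvent_nonneg j))
      (lift_injective (formResolvent_injective hd) T) x
  set P : ℕ → Lp H 2 (timeMeasure T) := fun n => lift T J (lift T (R n) p) with hP
  set W : ℕ → Lp H 2 (timeMeasure T) := fun n => lift T J (lift T (R n) w) with hW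
  have hPae : ∀ n, P n =ᵐ[timeMeasure T] fun t => R n (z t) := by
    intro n
    filter_upwards [coeFn_lift T J (lift T (R n) p), coeFn_lift T (R n) p, hz] with t h1 h2 h3
    rw [hP, h1, h2, ← hR.comm, h3]
  have hRz : ∀ n, ∀ t ∈ Icc 0 T, R n (z t) = R n a + prim (lift T (R n) w) t := by
    intro n t ht
    rw [hzdef, map_add, prim_congr (coeFn_lift T (R n) w) ht, prim_clm (R n) (Lp.memLp w) ht]
  have hdiff : ∀ n m, ∀ t ∈ Icc 0 T, T * ‖j.adjoint (R n (z t)) - j.adjoint (R m (z t))‖ ^ 2 ≤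
      ‖P n - P m‖ ^ 2 + 4 * T * (‖P n - P m‖ * ‖W n - W m‖) := by
    intro n m t ht
    have hpr : ∀ t ∈ Icc 0 T, R n (z t) - R m (z t) =
        (R n a - R m a) + prim (lift T (R n) w - lift T (R m) w : Lp H 2 (timeMeasure T)) t := by
      intro t ht
      have h1 : prim (lift T (R n) w - lift T (R m) w : Lp H 2 (timeMeasure T)) t =
          prim (lift T (R n) w) t - prim (lift T (R m) w) t := by
        rw [prim_congr (Lp.coeFn_sub _ _) ht]
        exact prim_sub (Lp.memLp _) (Lp.memLp _) ht
      rw [hRz n t ht, hRz m t ht, h1]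
      abel
    have h := norm_adjoint_prim_sq_le hj (lift T (R n) w - lift T (R m) w) (P n - P m)
      (R n a - R m a) (by
        filter_upwards [Lp.coeFn_sub (P n) (P m), hPae n, hPae m,
          ae_restrict_mem measurableSet_Ioo] with s h1 h2 h3 hs
        rw [h1, Pi.sub_apply, h2, h3, hpr s (Ioo_subset_Icc_self hs)]) ht
    rwa [← hpr t ht, map_sub, map_sub (lift T (formResolvent j))] at h
  have hcauchy : UniformCauchySeqOn (fun n t => j.adjoint (R n (z t))) atTop (Icc 0 T) := by
    rw [Metric.uniformCauchySeqOn_iff]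
    intro ε hε
    -- This `η` makes the bound `η² (1 + 4 T)` of `hdiff` equal to `T ε² / 2`.
    set η : ℝ := Real.sqrt (T * ε ^ 2 / (2 * (1 + 4 * T))) with hη
    have hη0 : 0 < η := Real.sqrt_pos.2 (by positivity)
    have hη2 : η ^ 2 * (1 + 4 * T) = T * ε ^ 2 / 2 := by
      rw [hη, Real.sq_sqrt (by positivity)]
      field_simp
    obtain ⟨N₁, hN₁⟩ := Metric.cauchySeq_iff.1 (hconv p).cauchySeq η hη0
    obtain ⟨N₂, hN₂⟩ := Metric.cauchySeq_iff.1 (hconv w).cauchySeq η hη0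
    refine ⟨max N₁ N₂, fun m hm n hn t ht => ?_⟩
    have h1 := (hN₁ m (le_of_max_le_left hm) n (le_of_max_le_left hn)).le
    have h2 := (hN₂ m (le_of_max_le_right hm) n (le_of_max_le_right hn)).le
    rw [dist_eq_norm] at h1 h2 ⊢
    have h3 := hdiff m n t ht
    have h4 : ‖P m - P n‖ ^ 2 ≤ η ^ 2 := pow_le_pow_left₀ (norm_nonneg _) h1 2
    have h5 : ‖P m - P n‖ * ‖W m - W n‖ ≤ η * η :=
      mul_le_mul h1 h2 (norm_nonneg _) hη0.le
    have h6 := mul_le_mul_of_nonneg_left h5 (by positivity : 0 ≤ 4 * T)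
    have h7 : T * ‖j.adjoint (R m (z t)) - j.adjoint (R n (z t))‖ ^ 2 < T * ε ^ 2 := by
      have : 0 < T * ε ^ 2 := by positivity
      linarith
    exact lt_of_pow_lt_pow_left₀ 2 hε.le (lt_of_mul_lt_mul_left h7 hT.le)
  have hlim : ∀ t, ∃ y : V, t ∈ Icc 0 T →
      Tendsto (fun n => j.adjoint (R n (z t))) atTop (𝓝 y) := by
    intro t
    by_cases ht : t ∈ Icc 0 T
    · obtain ⟨y, hy⟩ := cauchySeq_tendsto_of_complete (hcauchy.cauchySeq ht)
      exact ⟨y, fun _ => hy⟩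
    · exact ⟨0, fun h => absurd h ht⟩
  choose U hU using hlim
  have hUcont : ContinuousOn U (Icc 0 T) := by
    refine (hcauchy.tendstoUniformlyOn_of_tendsto fun t ht => hU t ht).continuousOn
      (Frequently.of_forall fun n => ?_)
    exact (j.adjoint ∘L R n).continuous.comp_continuousOn
      (continuousOn_const.add (continuousOn_prim hT.le (Lp.memLp w)))
  have hJR : ∀ t, Tendsto (fun n => J (R n (z t))) atTop (𝓝 (z t)) := fun t =>
    hR.tendsto (formResolvent_symm j) (formResolvent_nonneg j) (formResolvent_injective hd) (z t)
  refine ⟨U, hUcont, ?_, fun t ht => ?_, fun t ht => ?_⟩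
  · have h1 : Tendsto (fun n => lift T j.adjoint (P n)) atTop (𝓝 (lift T j.adjoint p)) :=
      ((lift T j.adjoint).continuous.tendsto p).comp (hconv p)
    obtain ⟨ns, hns, hae⟩ := (tendstoInMeasure_of_tendsto_Lp h1).exists_seq_tendsto_ae
    have h2 : ∀ᵐ t ∂timeMeasure T, ∀ n, lift T j.adjoint (P n) t = j.adjoint (R n (z t)) := by
      rw [ae_all_iff]
      intro n
      filter_upwards [coeFn_lift T j.adjoint (P n), hPae n] with t h3 h4
      rw [h3, h4]
    filter_upwards [hae, h2, coeFn_lift T j.adjoint p, ae_restrict_mem measurableSet_Ioo]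
      with t h3 h4 h5 ht
    rw [← h5]
    refine tendsto_nhds_unique ?_ h3
    simp only [h4]
    exact (hU t (Ioo_subset_Icc_self ht)).comp hns.tendsto_atTop
  · exact tendsto_nhds_unique ((j.continuous.tendsto _).comp (hU t ht)) (hJR t)
  · have h0 : (0 : ℝ) ∈ Icc 0 T := ⟨le_rfl, hT.le⟩
    have hb : ∀ t ∈ Icc 0 T, Tendsto
        (fun n => ‖j.adjoint (R n (z t))‖ ^ 2 - ‖j (j.adjoint (R n (z t)))‖ ^ 2) atTop
        (𝓝 (‖U t‖ ^ 2 - ‖j (U t)‖ ^ 2)) := fun t ht =>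
      ((hU t ht).norm.pow 2).sub ((((j.continuous.tendsto _).comp (hU t ht)).norm).pow 2)
    -- The quadratic form of `J - J²` at `x` is `‖j* x‖² - ‖j j* x‖²`, the form `a` at `j* x`.
    set S : H →L[ℝ] H := J - J ∘L J with hS
    have hSs : ∀ x y, ⟪S x, y⟫_ℝ = ⟪x, S y⟫_ℝ := by
      intro x y
      simp only [hS, hJ, sub_apply, ContinuousLinearMap.comp_apply, inner_sub_left,
        inner_sub_right, formResolvent_symm]
    have hSb : ∀ x, ⟪S x, x⟫_ℝ = ‖j.adjoint x‖ ^ 2 - ‖j (j.adjoint x)‖ ^ 2 := by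
      intro x
      rw [hS, sub_apply, ContinuousLinearMap.comp_apply, inner_sub_left, inner_formResolvent_self,
        hJ, formResolvent_symm, real_inner_self_eq_norm_sq, formResolvent_apply]
    have hen : ∀ n, ‖j.adjoint (R n (z t))‖ ^ 2 - ‖j (j.adjoint (R n (z t)))‖ ^ 2 =
        ‖j.adjoint (R n (z 0))‖ ^ 2 - ‖j (j.adjoint (R n (z 0)))‖ ^ 2 +
        2 * ⟪restrictTime H ht.2 (P n - lift T J (P n)), restrictTime H ht.2 (W n)⟫_ℝ := by
      intro n
      have h1 := inner_clm_prim_self hSs (Lp.memLp (lift T (R n) w)) ht (R n a)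
      have h2 : ∫ s in Ioo 0 t, ⟪S (R n a + prim (lift T (R n) w) s), lift T (R n) w s⟫_ℝ =
          ⟪restrictTime H ht.2 (P n - lift T J (P n)), restrictTime H ht.2 (W n)⟫_ℝ := by
        have hPJ : (P n - lift T J (P n) : Lp H 2 (timeMeasure T)) =ᵐ[timeMeasure T]
            fun s => R n (z s) - J (R n (z s)) := by
          filter_upwards [Lp.coeFn_sub (P n) (lift T J (P n)), hPae n, coeFn_lift T J (P n)]
            with s h3 h4 h5
          rw [h3, Pi.sub_apply, h5, h4]
        rw [← integral_inner_eq_restrictTime ht.2 hPJ (coeFn_lift T J (lift T (R n) w))]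
        refine setIntegral_congr_fun measurableSet_Ioo fun s hs => ?_
        have hs' : s ∈ Icc 0 T := ⟨hs.1.le, hs.2.le.trans ht.2⟩
        simp only [← hRz n s hs', hS, sub_apply, ContinuousLinearMap.comp_apply, ← map_sub]
        exact formResolvent_symm j _ _
      rw [h2, ← hRz n t ht, hSb, hSb] at h1
      rw [h1, hRz n 0 h0, prim_zero, add_zero]
    have hrhs : Tendsto (fun n => ‖j.adjoint (R n (z 0))‖ ^ 2 - ‖j (j.adjoint (R n (z 0)))‖ ^ 2 +
        2 * ⟪restrictTime H ht.2 (P n - lift T J (P n)), restrictTime H ht.2 (W n)⟫_ℝ) atTop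
        (𝓝 (‖U 0‖ ^ 2 - ‖j (U 0)‖ ^ 2 +
          2 * ⟪restrictTime H ht.2 (p - lift T J p), restrictTime H ht.2 w⟫_ℝ)) := by
      have h1 : Tendsto (fun n => P n - lift T J (P n)) atTop (𝓝 (p - lift T J p)) :=
        (hconv p).sub (((lift T J).continuous.tendsto p).comp (hconv p))
      exact (hb 0 h0).add ((Tendsto.inner (((restrictTime H ht.2).continuous.tendsto _).comp h1)
        (((restrictTime H ht.2).continuous.tendsto _).comp (hconv w))).const_mul 2)
    have hlhs := hb t ht
    simp only [hen] at hlhs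
    rw [tendsto_nhds_unique hlhs hrhs]
    congr 2
    symm
    refine integral_inner_eq_restrictTime ht.2 ?_ EventuallyEq.rfl
    filter_upwards [Lp.coeFn_sub p (lift T J p), coeFn_lift T J p] with s h3 h5
    rw [h3, Pi.sub_apply, h5]

end Form

/-! ### Existence for the abstract evolution equation -/

section Existence

variable {V H : Type*} [NormedAddCommGroup V] [InnerProductSpace ℝ V] [CompleteSpace V]
  [NormedAddCommGroup H] [InnerProductSpace ℝ H] [CompleteSpace H]

lemma inner_lift_prim {S : H →L[ℝ] H} (hS : ∀ x y, ⟪S x, y⟫_ℝ = ⟪x, S y⟫_ℝ) {T : ℝ} (hT : 0 ≤ T)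
    (q : Lp H 2 (timeMeasure T)) (a : H) :
    2 * ⟪lift T S (constLp T a + volterra H hT q), q⟫_ℝ =
      ⟪S (a + prim q T), a + prim q T⟫_ℝ - ⟪S a, a⟫_ℝ := by
  have h := inner_clm_prim_self hS (Lp.memLp q) ⟨hT, le_rfl⟩ a
  have h2 : ∫ s in Ioo 0 T, ⟪S (a + prim q s), q s⟫_ℝ =
      ⟪lift T S (constLp T a + volterra H hT q), q⟫_ℝ := by
    refine integral_inner_eq ?_ EventuallyEq.rfl
    filter_upwards [coeFn_lift T S (constLp T a + volterra H hT q),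
      coeFn_constLp_add_volterra hT a q] with t h3 h4
    rw [h3, h4]
  rw [h, h2]
  ring

/-- The evolution equation with `A = J⁻¹ - 1` replaced by the bounded operator
`(1 - J) (J + ε)⁻¹`, which tends to `A` as `ε → 0`: there is a solution, and its derivative `w`
is bounded independently of `ε`. -/
lemma exists_approximate_solution {j : V →L[ℝ] H} (hj : ∀ v, ‖j v‖ ≤ ‖v‖) {T : ℝ} (hT : 0 ≤ T)
    (f : Lp H 2 (timeMeasure T)) (u₀ : V) {ε : ℝ} (hε : 0 < ε) :
    ∃ w : Lp H 2 (timeMeasure T), ‖w‖ ≤ ‖f‖ + ‖u₀‖ ∧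
      lift T (formResolvent j + ε • 1) w +
        lift T (1 - formResolvent j) (constLp T (j u₀) + volterra H hT w) =
      lift T (formResolvent j + ε • 1) f := by
  set J := formResolvent j with hJ
  set B : H →L[ℝ] H := J + ε • 1 with hB
  set N : H →L[ℝ] H := 1 - J with hN
  have hBx : ∀ x, B x = J x + ε • x := fun x => rfl
  have hNx : ∀ x, N x = x - J x := fun x => rfl
  have hJs : ∀ x y, ⟪J x, y⟫_ℝ = ⟪x, J y⟫_ℝ := formResolvent_symm j
  have hBs : ∀ x y, ⟪B x, y⟫_ℝ = ⟪x, B y⟫_ℝ := fun x y => by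
    rw [hBx, hBx, inner_add_left, inner_add_right, hJs, real_inner_smul_left,
      real_inner_smul_right]
  have hNs : ∀ x y, ⟪N x, y⟫_ℝ = ⟪x, N y⟫_ℝ := fun x y => by
    rw [hNx, hNx, inner_sub_left, inner_sub_right, hJs]
  have hBN : ∀ x, B (N x) = N (B x) := fun x => by
    simp only [hBx, hNx, map_sub, map_add, map_smul, smul_sub]
    abel
  have hNpos : ∀ x, 0 ≤ ⟪N x, x⟫_ℝ := fun x => by
    rw [hNx]
    exact formResolvent_complement_nonneg hj x
  set S : H →L[ℝ] H := B ∘L N with hS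
  have hSx : ∀ x, S x = B (N x) := fun x => rfl
  have hSs : ∀ x y, ⟪S x, y⟫_ℝ = ⟪x, S y⟫_ℝ := fun x y => by
    rw [hSx, hSx, hBs, hNs, hBN]
  have hSpos : ∀ x, 0 ≤ ⟪S x, x⟫_ℝ := fun x => by
    have h1 : ⟪J (N x), x⟫_ℝ = ‖j.adjoint x‖ ^ 2 - ‖J x‖ ^ 2 := by
      rw [hJs, hNx, inner_sub_left, real_inner_self_eq_norm_sq, ← hJs, hJ, inner_formResolvent_self]
    rw [hSx, hBx, inner_add_left, real_inner_smul_left, h1]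
    have h2 : ‖J x‖ ≤ ‖j.adjoint x‖ := hj _
    have h3 := pow_le_pow_left₀ (norm_nonneg _) h2 2
    have h4 := mul_nonneg hε.le (hNpos x)
    linarith
  obtain ⟨R, hR, -⟩ := exists_inverse_of_coercive B hε fun x => by
    rw [hBx, inner_add_left, real_inner_smul_left, real_inner_self_eq_norm_sq]
    linarith [formResolvent_nonneg j x]
  set z₀ := R (j u₀) with hz₀
  have hBz : B z₀ = j u₀ := hR _
  -- The initial value enters through `(N (J + ε)⁻¹ j u₀, j u₀) ≤ ‖u₀‖²`, uniformly in `ε`.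
  have hinit : ⟪S z₀, z₀⟫_ℝ ≤ ‖u₀‖ ^ 2 := by
    have e1 : ⟪S z₀, z₀⟫_ℝ = ⟪z₀, j u₀⟫_ℝ - ⟪J z₀, j u₀⟫_ℝ := by
      rw [hSx, hBs, hBz, hNx, inner_sub_left]
    have e2 : 0 ≤ ⟪J z₀, j u₀⟫_ℝ := by
      rw [← hBz, hBx, inner_add_right, real_inner_self_eq_norm_sq, real_inner_smul_right]
      have := mul_nonneg hε.le (formResolvent_nonneg j z₀)
      positivity
    have e3 : ⟪z₀, j u₀⟫_ℝ = ⟪j.adjoint z₀, u₀⟫_ℝ := by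
      rw [ContinuousLinearMap.adjoint_inner_left]
    have e4 : ‖j.adjoint z₀‖ ^ 2 ≤ ⟪z₀, j u₀⟫_ℝ := by
      rw [← hBz, hBx, inner_add_right, ← hJs, inner_formResolvent_self, real_inner_smul_right,
        real_inner_self_eq_norm_sq]
      have : 0 ≤ ε * ‖z₀‖ ^ 2 := by positivity
      linarith
    have e5 := real_inner_le_norm (j.adjoint z₀) u₀
    rw [← e3] at e5
    have e6 : ‖j.adjoint z₀‖ ≤ ‖u₀‖ := by
      by_contra! hlt
      nlinarith [norm_nonneg u₀]
    nlinarith [norm_nonneg u₀]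
  -- The unknown is `q = (J + ε)⁻¹ u'`. The Volterra term is accretive: twice its product with `q`
  -- is `(N y, y)` with `y = ∫₀ᵀ q`. So the term `ε q` makes the operator coercive.
  obtain ⟨Q, hQ, -⟩ := exists_inverse_of_coercive (lift T B + lift T N ∘L volterra H hT) hε
    fun x => by
      have h1 := inner_lift_prim hNs hT x 0
      have h2 := lift_nonneg (formResolvent_nonneg j) x
      have h3 : constLp T (0 : H) = 0 := map_zero (Lp.constL 2 (timeMeasure T) ℝ (E := H))
      rw [h3, zero_add, zero_add, map_zero, inner_zero_left, sub_zero] at h1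
      rw [add_apply, ContinuousLinearMap.comp_apply, inner_add_left, hB, lift_add_smul,
        inner_add_left, real_inner_smul_left, real_inner_self_eq_norm_sq]
      linarith [hNpos (prim x T)]
  set q := Q (f - lift T N (constLp T z₀)) with hq
  have hqe : lift T B q + lift T N (constLp T z₀ + volterra H hT q) = f := by
    have := hQ (f - lift T N (constLp T z₀))
    rw [← hq, add_apply, ContinuousLinearMap.comp_apply] at this
    rw [map_add, add_left_comm, this, add_sub_cancel]
  refine ⟨lift T B q, ?_, ?_⟩
  · -- The equation is tested with `u' = (J + ε) q`.
    have h1 := congrArg (fun x => ⟪x, lift T B q⟫_ℝ) hqe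
    simp only [inner_add_left _ _ (lift T B q), real_inner_self_eq_norm_sq] at h1
    have h2 := inner_lift_prim hSs hT q z₀
    rw [hS, lift_comp, lift_symm hBs, ← hS] at h2
    have h3 := real_inner_le_norm f (lift T B q)
    have h4 := hSpos (z₀ + prim q T)
    have h5 : ‖lift T B q‖ ^ 2 ≤ ‖f‖ * ‖lift T B q‖ + ‖u₀‖ ^ 2 / 2 := by linarith
    by_contra! hlt
    nlinarith [norm_nonneg f, norm_nonneg u₀, norm_nonneg (lift T B q)]
  · rw [← hBz, ← lift_constLp, ← lift_volterra, ← map_add (lift T B), ← hqe,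
      map_add (lift T B) (lift T B q)]
    congr 1
    rw [← lift_comp, ← lift_comp]
    congr 2
    ext x
    exact (hBN x).symm

/-- The equation `u' + A u = f`, `u(0) = j u₀`, with `A = J⁻¹ - 1`, has a solution: `u = J p` and
`A u = p - J p`. It is a weak limit of the solutions of the approximating equations. -/
theorem exists_solution {j : V →L[ℝ] H} (hj : ∀ v, ‖j v‖ ≤ ‖v‖) {T : ℝ} (hT : 0 ≤ T)
    (f : Lp H 2 (timeMeasure T)) (u₀ : V) :
    ∃ p w : Lp H 2 (timeMeasure T),
      (∀ᵐ t ∂timeMeasure T, formResolvent j (p t) = j u₀ + prim w t) ∧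
      ∀ᵐ t ∂timeMeasure T, p t - formResolvent j (p t) = f t - w t := by
  set J := formResolvent j with hJ
  choose w hwb hw using fun n => exists_approximate_solution hj hT f u₀ (eps_pos n)
  obtain ⟨y, hy⟩ := exists_weak_limit w _ hwb
  have hε : Tendsto eps (hyperfilter ℕ) (𝓝 0) :=
    tendsto_eps.mono_left (Nat.cofinite_eq_atTop ▸ hyperfilter_le_cofinite)
  have hclm : ∀ (A : Lp H 2 (timeMeasure T) →L[ℝ] Lp H 2 (timeMeasure T)) x,
      Tendsto (fun n => ⟪A (w n), x⟫_ℝ) (hyperfilter ℕ) (𝓝 ⟪A y, x⟫_ℝ) := by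
    intro A x
    simp only [← ContinuousLinearMap.adjoint_inner_right]
    exact hy _
  have hlim : lift T J y + lift T (1 - J) (constLp T (j u₀) + volterra H hT y) = lift T J f := by
    refine ext_inner_right ℝ fun x => ?_
    have e : ∀ n, ⟪lift T J (w n), x⟫_ℝ + eps n * ⟪w n, x⟫_ℝ +
        (⟪lift T (1 - J) (constLp T (j u₀)), x⟫_ℝ +
          ⟪(lift T (1 - J) ∘L volterra H hT) (w n), x⟫_ℝ) =
        ⟪lift T J f, x⟫_ℝ + eps n * ⟪f, x⟫_ℝ := by
      intro n
      have := congrArg (fun z => ⟪z, x⟫_ℝ) (hw n)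
      rw [lift_add_smul, lift_add_smul, map_add] at this
      simp only [inner_add_left, real_inner_smul_left] at this
      exact this
    have h1 := ((hclm (lift T J) x).add (hε.mul (hy x))).add
      ((tendsto_const_nhds (x := ⟪lift T (1 - J) (constLp T (j u₀)), x⟫_ℝ)).add
        (hclm (lift T (1 - J) ∘L volterra H hT) x))
    have h2 : Tendsto (fun n => ⟪lift T J f, x⟫_ℝ + eps n * ⟪f, x⟫_ℝ) (hyperfilter ℕ)
        (𝓝 (⟪lift T J f, x⟫_ℝ + 0 * ⟪f, x⟫_ℝ)) :=
      tendsto_const_nhds.add (hε.mul_const _)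
    simp only [e] at h1
    have h3 := tendsto_nhds_unique h1 h2
    rw [zero_mul, zero_mul, add_zero, add_zero] at h3
    rw [map_add, inner_add_left, inner_add_left]
    exact h3
  -- With `z = u`, the limit equation `J u' + (1 - J) u = J f` says `J (f - u' + u) = u`.
  set z := constLp T (j u₀) + volterra H hT y with hz
  have hp : lift T J (f - y + z) = z := by
    rw [lift_one_sub] at hlim
    rw [map_add, map_sub, ← hlim]
    abel
  refine ⟨f - y + z, y, ?_, ?_⟩
  · filter_upwards [coeFn_lift T J (f - y + z), coeFn_constLp_add_volterra hT (j u₀) y]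
      with t h1 h2
    rw [← h1, hp, hz, h2]
  · filter_upwards [coeFn_lift T J (f - y + z), Lp.coeFn_add (f - y) z, Lp.coeFn_sub f y]
      with t h1 h2 h3
    rw [← h1, hp, h2, Pi.add_apply, h3, Pi.sub_apply, add_sub_cancel_right]

end Existence

/-! ### The spaces `V_κ` and `L²_κ` -/

lemma continuous_integral_coord_mul {ι : Type*} [Fintype ι] {μ : Measure R2} (i : ι) {ψ : R2 → ℝ}
    (hψ : MemLp ψ 2 μ) :
    Continuous fun u : Lp (EuclideanSpace ℝ ι) 2 μ => ∫ x, u x i * ψ x ∂μ := by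
  classical
  have hg : MemLp (fun x => ψ x • EuclideanSpace.single i (1 : ℝ)) 2 μ :=
    hψ.continuousLinearMap_comp
      ((ContinuousLinearMap.id ℝ ℝ).smulRight (EuclideanSpace.single i (1 : ℝ)))
  have h : (fun u : Lp (EuclideanSpace ℝ ι) 2 μ => ∫ x, u x i * ψ x ∂μ) =
      fun u => ⟪u, hg.toLp _⟫_ℝ := by
    funext u
    rw [L2.inner_def]
    refine integral_congr_ae ?_
    filter_upwards [hg.coeFn_toLp] with x hx
    rw [hx, real_inner_smul_right, EuclideanSpace.inner_single_right]
    simp [mul_comm]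
  rw [h]
  fun_prop

lemma isClosed_W12 (Ω : Set R2) : IsClosed (W12 Ω : Set (WithLp 2 (L2Vec Ω × L2Mat Ω))) := by
  have h : (W12 Ω : Set (WithLp 2 (L2Vec Ω × L2Mat Ω))) =
      ⋂ (φ : R2 → ℝ) (_ : ContDiff ℝ ∞ φ) (_ : HasCompactSupport φ) (_ : tsupport φ ⊆ Ω)
        (i : Fin 2) (j : Fin 2), {p | ∫ x in Ω, p.fst x i * partialDeriv j φ x =
          -∫ x in Ω, p.snd x (i, j) * φ x} := by
    ext p
    simp only [mem_iInter]
    exact Iff.rfl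
  rw [h]
  refine isClosed_iInter fun φ => isClosed_iInter fun hφ => isClosed_iInter fun hc =>
    isClosed_iInter fun _ => isClosed_iInter fun i => isClosed_iInter fun j => ?_
  have hp := WithLp.prod_continuous_ofLp 2 (L2Vec Ω) (L2Mat Ω)
  exact isClosed_eq
    ((continuous_integral_coord_mul i (memLp_continuous_compactSupport
      (continuous_partialDeriv hφ j) (hasCompactSupport_partialDeriv hc j) _)).comp hp.fst)
    ((continuous_integral_coord_mul (i, j) (memLp_continuous_compactSupport
      hφ.continuous hc _)).comp hp.snd).neg

instance (P : ChannelDomain) : CompleteSpace (Vkappa P) :=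
  haveI : CompleteSpace (W12 P.Ω) := (isClosed_W12 P.Ω).completeSpace_coe
  inferInstanceAs (CompleteSpace (smoothW12 P.Ω P.ΓD).topologicalClosure)

variable {P : ChannelDomain}

lemma inner_Vkappa (w v : Vkappa P) :
    ⟪w, v⟫_ℝ = ⟪toLkappa w, toLkappa v⟫_ℝ + gradInner w v :=
  WithLp.prod_inner_apply w.1.1 v.1.1

lemma gradInner_self (w : Vkappa P) : gradInner w w = ‖w‖ ^ 2 - ‖toLkappa w‖ ^ 2 := by
  rw [← real_inner_self_eq_norm_sq, ← real_inner_self_eq_norm_sq, inner_Vkappa]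
  ring

lemma gradInner_self_nonneg (w : Vkappa P) : 0 ≤ gradInner w w := real_inner_self_nonneg

lemma norm_toLkappa_le (w : Vkappa P) : ‖toLkappa w‖ ≤ ‖w‖ := by
  have h1 := gradInner_self w
  have h2 := gradInner_self_nonneg w
  exact le_of_abs_le (abs_le_of_sq_le_sq (by linarith) (norm_nonneg _))

/-- The inclusion `V_κ ⊂ L²_κ` as a bounded operator. -/
def inclusion (P : ChannelDomain) : Vkappa P →L[ℝ] Lkappa P :=
  LinearMap.mkContinuous
    { toFun := toLkappa
      map_add' := fun _ _ => rfl
      map_smul' := fun _ _ => rfl } 1 fun w => (norm_toLkappa_le w).trans (one_mul _).ge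

@[simp] lemma inclusion_apply (w : Vkappa P) : inclusion P w = toLkappa w := rfl

/-- A function determines its weak gradient. -/
lemma toLkappa_injective : Function.Injective (toLkappa (P := P)) := by
  change Function.Injective (inclusion P)
  rw [injective_iff_map_eq_zero]
  intro w hw
  have hf : field w = 0 := congrArg Subtype.val hw
  have hz : ∀ ij : Fin 2 × Fin 2, ∀ᵐ x ∂volume.restrict P.Ω, grad w x ij = 0 := by
    rintro ⟨i, j⟩
    have hG := memLp_coord (grad w) (i, j)
    have hloc : LocallyIntegrableOn (fun x => grad w x (i, j)) P.Ω (volume.restrict P.Ω) :=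
      (hG.locallyIntegrable (by norm_num)).locallyIntegrableOn _
    have key := P.isOpen.ae_eq_zero_of_integral_contDiff_smul_eq_zero hloc (by
      intro φ hφ hc hs
      have h1 : ∫ x in P.Ω, field w x i * partialDeriv j φ x =
        -∫ x in P.Ω, grad w x (i, j) * φ x := w.1.2 φ hφ hc hs i j
      have h2 : ∫ x in P.Ω, field w x i * partialDeriv j φ x = 0 := by
        rw [hf, ← integral_zero R2 ℝ (μ := volume.restrict P.Ω)]
        refine integral_congr_ae ?_
        filter_upwards [Lp.coeFn_zero R2 2 (volume.restrict P.Ω)] with x hx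
        rw [hx]
        simp
      simp only [smul_eq_mul, mul_comm (φ _)]
      linarith)
    filter_upwards [key, ae_restrict_mem P.isOpen.measurableSet] with x hx hm using hx hm
  have hg : grad w = 0 := by
    refine Lp.ext ?_
    filter_upwards [ae_all_iff.2 hz, Lp.coeFn_zero Mat2 2 (volume.restrict P.Ω)] with x h1 h2
    rw [h2]
    ext ij
    exact h1 ij
  have h := gradInner_self w
  rw [gradInner, hg, inner_zero_left, ← inclusion_apply, hw, norm_zero] at h
  simpa using h.symm

lemma denseRange_inclusion : DenseRange (inclusion P) := denseRange_toLkappa P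

/-- `A w = f` means `w = (1 + A)⁻¹ (f + w)`. -/
lemma corresponds_iff {w : Vkappa P} {f : Lkappa P} :
    Corresponds w f ↔ w = (inclusion P).adjoint (f + toLkappa w) := by
  have h : ∀ v, ⟪(inclusion P).adjoint (f + toLkappa w), v⟫_ℝ =
      ⟪f, toLkappa v⟫_ℝ + ⟪toLkappa w, toLkappa v⟫_ℝ := fun v => by
    rw [ContinuousLinearMap.adjoint_inner_left, inclusion_apply, inner_add_left]
  constructor
  · intro hc
    refine ext_inner_right ℝ fun v => ?_
    rw [h, inner_Vkappa, hc v, add_comm]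
  · intro hc v
    have := inner_Vkappa w v
    nth_rewrite 1 [hc] at this
    rw [h] at this
    linarith

lemma corresponds_adjoint (x : Lkappa P) :
    Corresponds ((inclusion P).adjoint x) (x - formResolvent (inclusion P) x) := by
  rw [corresponds_iff, formResolvent_apply, inclusion_apply, sub_add_cancel]

lemma corresponds_dataOf {w : Vkappa P} (hw : w ∈ spaceD P) : Corresponds w (dataOf w) := by
  rw [dataOf, dif_pos hw]
  exact hw.choose_spec

lemma dataOf_eq {w : Vkappa P} {f : Lkappa P} (h : Corresponds w f) : dataOf w = f :=
  (corresponds_dataOf ⟨f, h⟩).unique h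

lemma Corresponds.sub {w v : Vkappa P} {f g : Lkappa P} (hf : Corresponds w f)
    (hg : Corresponds v g) : Corresponds (w - v) (f - g) := by
  rw [corresponds_iff] at hf hg ⊢
  have h : toLkappa (w - v) = toLkappa w - toLkappa v := map_sub (inclusion P) w v
  rw [h, ← add_sub_add_comm, map_sub, ← hf, ← hg]

/-! ### The space `X` -/

variable {T : ℝ}

lemma isTimeDeriv_timeDeriv (u : SpaceX P T) : IsTimeDeriv u.1 (timeDeriv u) := u.2.2.choose_spec

lemma timeDeriv_eq {u : SpaceX P T} {g : L2Lkappa P T} (h : IsTimeDeriv u.1 g) :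
    timeDeriv u = g := (isTimeDeriv_timeDeriv u).unique h

lemma memLp_toLkappa (u : L2Vkappa P T) : MemLp (fun t => toLkappa (u t)) 2 (timeMeasure T) :=
  (Lp.memLp u).continuousLinearMap_comp (inclusion P)

lemma IsTimeDeriv.sub {u v : L2Vkappa P T} {g h : L2Lkappa P T} (hg : IsTimeDeriv u g)
    (hh : IsTimeDeriv v h) : IsTimeDeriv (u - v) (g - h) := by
  intro φ hφ hc hs
  have e1 : ∫ t in Ioo 0 T, deriv φ t • toLkappa ((u - v : L2Vkappa P T) t) =
      ∫ t in Ioo 0 T, (deriv φ t • toLkappa (u t) - deriv φ t • toLkappa (v t)) := by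
    refine integral_congr_ae ?_
    filter_upwards [Lp.coeFn_sub u v] with t ht
    rw [ht, Pi.sub_apply, ← smul_sub]
    exact congrArg _ (map_sub (inclusion P) _ _)
  have e2 : ∫ t in Ioo 0 T, φ t • (g - h : L2Lkappa P T) t =
      ∫ t in Ioo 0 T, (φ t • g t - φ t • h t) := by
    refine integral_congr_ae ?_
    filter_upwards [Lp.coeFn_sub g h] with t ht
    rw [ht, Pi.sub_apply, ← smul_sub]
  have hd : Continuous (deriv φ) := hφ.continuous_deriv (by simp)
  rw [e1, e2, integral_sub (integrable_smul_of_memLp (memLp_toLkappa u) hd hc.deriv)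
    (integrable_smul_of_memLp (memLp_toLkappa v) hd hc.deriv),
    integral_sub (integrable_smul_of_memLp (Lp.memLp g) hφ.continuous hc)
    (integrable_smul_of_memLp (Lp.memLp h) hφ.continuous hc), hg φ hφ hc hs, hh φ hφ hc hs]
  abel

lemma ae_corresponds (u : SpaceX P T) :
    ∀ᵐ t ∂timeMeasure T, Corresponds (u.1 t) (dataOf (u.1 t)) :=
  u.2.1.1.mono fun _ h => corresponds_dataOf h

lemma ae_dataOf_sub (u v : SpaceX P T) :
    ∀ᵐ t ∂timeMeasure T, Corresponds ((u.1 - v.1 : L2Vkappa P T) t)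
      (dataOf (u.1 t) - dataOf (v.1 t)) := by
  filter_upwards [ae_corresponds u, ae_corresponds v, Lp.coeFn_sub u.1 v.1] with t h1 h2 h3
  rw [h3]
  exact h1.sub h2

/-- The difference of two elements of `X`. -/
def SpaceX.sub (u v : SpaceX P T) : SpaceX P T :=
  ⟨u.1 - v.1, ⟨(ae_dataOf_sub u v).mono fun _ h => ⟨_, h⟩,
    (u.2.1.2.sub v.2.1.2).ae_eq ((ae_dataOf_sub u v).mono fun _ h => (dataOf_eq h).symm)⟩,
    timeDeriv u - timeDeriv v, (isTimeDeriv_timeDeriv u).sub (isTimeDeriv_timeDeriv v)⟩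

/-- The Stokes equation says `u' + A u = f` in `L²_κ`, almost everywhere in time. -/
lemma satisfiesStokes_iff {u : SpaceX P T} {f : L2Lkappa P T} :
    SatisfiesStokes u f ↔ ∀ᵐ t ∂timeMeasure T, timeDeriv u t + dataOf (u.1 t) = f t := by
  constructor
  · intro h
    filter_upwards [h, ae_corresponds u] with t h1 h2
    refine (denseRange_toLkappa P).eq_of_inner_left ℝ fun v => ?_
    rw [inner_add_left, ← h2 v, h1 v]
  · intro h
    filter_upwards [h, ae_corresponds u] with t h1 h2 v
    rw [h2 v, ← inner_add_left, h1]

/-- Elements of `X` are represented by continuous functions with values in `V_κ`, for which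
`‖u(t)‖²_{V_κ}` is the primitive of `2 (A u, u')`. -/
theorem SpaceX.exists_representative (hT : 0 < T) (u : SpaceX P T) :
    ∃ U : ℝ → Vkappa P, ContinuousOn U (Icc 0 T) ∧ (∀ᵐ t ∂timeMeasure T, u.1 t = U t) ∧
      (∀ t ∈ Icc 0 T, toLkappa (U t) = toLkappa (U 0) + prim (timeDeriv u) t) ∧
      ∀ t ∈ Icc 0 T, gradInner (U t) (U t) = gradInner (U 0) (U 0) +
        2 * ∫ s in Ioo 0 t, ⟪dataOf (u.1 s), timeDeriv u s⟫_ℝ := by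
  have hw := Lp.memLp (timeDeriv u)
  obtain ⟨a, ha⟩ := ae_eq_const_of_integral_deriv_smul_eq_zero hT
    ((memLp_toLkappa u.1).sub (prim_memLp hT.le hw)) (by
      intro φ hφ hc hs
      have hd : Continuous (deriv φ) := hφ.continuous_deriv (by simp)
      have h1 := integral_deriv_smul_prim hT hw 0 hφ hs
      have h2 := isTimeDeriv_timeDeriv u φ hφ hc hs
      simp only [zero_add] at h1
      simp only [Pi.sub_apply, smul_sub]
      rw [integral_sub (integrable_smul_of_memLp (memLp_toLkappa u.1) hd hc.deriv)
        (integrable_smul_of_memLp (prim_memLp hT.le hw) hd hc.deriv), h1, h2, sub_self])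
  have hpm : MemLp (fun t => dataOf (u.1 t) + toLkappa (u.1 t)) 2 (timeMeasure T) :=
    u.2.1.2.add (memLp_toLkappa u.1)
  have hup : ∀ᵐ t ∂timeMeasure T, u.1 t = (inclusion P).adjoint (hpm.toLp _ t) := by
    filter_upwards [ae_corresponds u, hpm.coeFn_toLp] with t h1 h2
    rw [h2]
    exact corresponds_iff.1 h1
  obtain ⟨U, hUc, hU, hUj, hUe⟩ := exists_continuous_representative
    (j := inclusion P) norm_toLkappa_le denseRange_inclusion hT (hpm.toLp _) (timeDeriv u) a (by
      filter_upwards [hup, ha] with t h1 h2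
      rw [formResolvent_apply, ← h1, inclusion_apply, ← h2]
      simp)
  have hU0 : toLkappa (U 0) = a := by
    have := hUj 0 ⟨le_rfl, hT.le⟩
    rwa [prim_zero, add_zero] at this
  refine ⟨U, hUc, ?_, fun t ht => ?_, fun t ht => ?_⟩
  · filter_upwards [hU, hup] with t h1 h2
    rw [h1, h2]
  · rw [hU0]
    exact hUj t ht
  · rw [gradInner_self, gradInner_self]
    refine (hUe t ht).trans ?_
    congr 2
    refine integral_congr_ae (ae_mono (Measure.restrict_mono (Ioo_subset_Ioo_right ht.2) le_rfl) ?_)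
    filter_upwards [hup, hpm.coeFn_toLp] with s h1 h2
    rw [formResolvent_apply, ← h1, h2, inclusion_apply, add_sub_cancel_right]

lemma HasInitialValue.unique (hT : 0 < T) {u : SpaceX P T} {a b : Vkappa P}
    (ha : HasInitialValue u a) (hb : HasInitialValue u b) : a = b := by
  obtain ⟨U, hU, hUu, rfl⟩ := ha
  obtain ⟨W, hW, hWu, rfl⟩ := hb
  refine Measure.eqOn_Icc_of_ae_eq volume hT.ne ?_ hU hW ⟨le_rfl, hT.le⟩
  rw [← restrict_Ioo_eq_restrict_Icc]
  filter_upwards [hUu, hWu] with t h1 h2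
  rw [← h1, ← h2]

lemma exists_hasInitialValue (hT : 0 < T) (u : SpaceX P T) : ∃ a, HasInitialValue u a := by
  obtain ⟨U, hU, hUu, -, -⟩ := u.exists_representative hT
  exact ⟨U 0, U, hU, hUu, rfl⟩

lemma exists_satisfiesStokes (u : SpaceX P T) : ∃ f : L2Lkappa P T, SatisfiesStokes u f := by
  refine ⟨timeDeriv u + u.2.1.2.toLp _, satisfiesStokes_iff.2 ?_⟩
  filter_upwards [Lp.coeFn_add (timeDeriv u) (u.2.1.2.toLp _), u.2.1.2.coeFn_toLp] with t h1 h2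
  rw [h1, Pi.add_apply, h2]

lemma SatisfiesStokes.unique {u : SpaceX P T} {f g : L2Lkappa P T} (hf : SatisfiesStokes u f)
    (hg : SatisfiesStokes u g) : f = g := by
  refine Lp.ext ?_
  filter_upwards [satisfiesStokes_iff.1 hf, satisfiesStokes_iff.1 hg] with t h1 h2
  rw [← h1, h2]

/-! ### The non-steady Stokes problem -/

theorem exists_isGeneralizedSolution (hT : 0 < T) (f : L2Lkappa P T) (u₀ : Vkappa P) :
    ∃ u : SpaceX P T, IsGeneralizedSolution u f u₀ := by
  obtain ⟨p, w, hp, hf⟩ := exists_solution (j := inclusion P) norm_toLkappa_le hT.le f u₀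
  have hu := coeFn_lift T (inclusion P).adjoint p
  have hc : ∀ᵐ t ∂timeMeasure T,
      Corresponds (lift T (inclusion P).adjoint p t) (f t - w t) := by
    filter_upwards [hu, hf] with t h1 h2
    rw [h1, ← h2]
    exact corresponds_adjoint _
  have hd : IsTimeDeriv (lift T (inclusion P).adjoint p) w := by
    intro φ hφ hc hs
    rw [← integral_deriv_smul_prim hT (Lp.memLp w) (toLkappa u₀) hφ hs]
    refine integral_congr_ae ?_
    filter_upwards [hu, hp] with t h1 h2
    rw [h1, ← inclusion_apply, ← formResolvent_apply, h2, inclusion_apply]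
  let u : SpaceX P T := ⟨lift T (inclusion P).adjoint p,
    ⟨hc.mono fun _ h => ⟨_, h⟩, ((Lp.memLp f).sub (Lp.memLp w)).ae_eq
      (hc.mono fun _ h => (dataOf_eq h).symm)⟩, w, hd⟩
  refine ⟨u, satisfiesStokes_iff.2 ?_, ?_⟩
  · rw [timeDeriv_eq (u := u) hd]
    filter_upwards [hc] with t h
    rw [dataOf_eq h, add_sub_cancel]
  · obtain ⟨U, hUc, hU, hUj, -⟩ := exists_continuous_representative
      (j := inclusion P) norm_toLkappa_le denseRange_inclusion hT p w (toLkappa u₀) hp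
    refine ⟨U, hUc, ?_, toLkappa_injective ?_⟩
    · filter_upwards [hU, hu] with t h1 h2
      rw [h1]
      exact h2
    · have := hUj 0 ⟨le_rfl, hT.le⟩
      rwa [prim_zero, add_zero] at this

/-- The energy inequality, obtained from `u' + A u = f` tested with `u'`. -/
lemma IsGeneralizedSolution.energy_le (hT : 0 < T) {u : SpaceX P T} {f : L2Lkappa P T}
    {u₀ : Vkappa P} (h : IsGeneralizedSolution u f u₀) :
    ‖timeDeriv u‖ ≤ ‖f‖ + normV u₀ ∧ ∀ᵐ t ∂timeMeasure T, normV (u.1 t) ≤ ‖f‖ + normV u₀ := by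
  obtain ⟨U, hUc, hU, -, hUe⟩ := u.exists_representative hT
  have hU0 : U 0 = u₀ := HasInitialValue.unique hT ⟨U, hUc, hU, rfl⟩ h.2
  have hn : normV u₀ ^ 2 = gradInner u₀ u₀ := Real.sq_sqrt (gradInner_self_nonneg _)
  have hn0 : 0 ≤ normV u₀ := Real.sqrt_nonneg _
  have hsq : ∀ (q : L2Lkappa P T), Integrable (fun s => ‖q s‖ ^ 2) (timeMeasure T) := fun q =>
    (Lp.memLp q).integrable_norm_pow (by norm_num)
  have hnorm : ∀ (q : L2Lkappa P T), ∫ s in Ioo 0 T, ‖q s‖ ^ 2 = ‖q‖ ^ 2 := by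
    intro q
    rw [← real_inner_self_eq_norm_sq, L2.inner_def]
    simp only [real_inner_self_eq_norm_sq]
  have key : ∀ t ∈ Icc 0 T, gradInner (U t) (U t) + ∫ s in Ioo 0 t, ‖timeDeriv u s‖ ^ 2 ≤
      gradInner u₀ u₀ + ‖f‖ ^ 2 := by
    intro t ht
    have hm : timeMeasure t ≤ timeMeasure T :=
      Measure.restrict_mono (Ioo_subset_Ioo_right ht.2) le_rfl
    have h1 : ∫ s in Ioo 0 t, 2 * ⟪dataOf (u.1 s), timeDeriv u s⟫_ℝ ≤
        ∫ s in Ioo 0 t, (‖f s‖ ^ 2 - ‖timeDeriv u s‖ ^ 2) := by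
      refine integral_mono_ae ((integrable_inner_of_memLp (memLp_mono_time u.2.1.2 ht.2)
        (memLp_mono_time (Lp.memLp (timeDeriv u)) ht.2)).const_mul 2)
        (((hsq f).sub (hsq _)).mono_measure hm) ?_
      filter_upwards [ae_mono hm (satisfiesStokes_iff.1 h.1)] with s hs
      have h3 : dataOf (u.1 s) = f s - timeDeriv u s := eq_sub_of_add_eq' hs
      simp only [h3, inner_sub_left, real_inner_self_eq_norm_sq]
      have h4 := real_inner_le_norm (f s) (timeDeriv u s)
      nlinarith [sq_nonneg (‖f s‖ - ‖timeDeriv u s‖)]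
    rw [integral_const_mul, integral_sub ((hsq f).mono_measure hm) ((hsq _).mono_measure hm)] at h1
    have h2 : ∫ s in Ioo 0 t, ‖f s‖ ^ 2 ≤ ‖f‖ ^ 2 := by
      rw [← hnorm]
      exact setIntegral_mono_set (hsq f) (ae_of_all _ fun _ => by positivity)
        (Ioo_subset_Ioo_right ht.2).eventuallyLE
    have h3 := hUe t ht
    rw [hU0] at h3
    linarith
  refine ⟨?_, ?_⟩
  · have h1 := key T ⟨hT.le, le_rfl⟩
    rw [hnorm] at h1
    refine le_of_abs_le (abs_le_of_sq_le_sq ?_ (by positivity))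
    nlinarith [gradInner_self_nonneg (U T), mul_nonneg (norm_nonneg f) hn0]
  · filter_upwards [hU, ae_restrict_mem measurableSet_Ioo] with t h1 ht
    have h2 := key t (Ioo_subset_Icc_self ht)
    have h3 : 0 ≤ ∫ s in Ioo 0 t, ‖timeDeriv u s‖ ^ 2 := integral_nonneg fun _ => by positivity
    rw [h1]
    refine Real.sqrt_le_iff.2 ⟨by positivity, ?_⟩
    nlinarith [mul_nonneg (norm_nonneg f) hn0]

theorem IsGeneralizedSolution.norm_le (hT : 0 < T) {u : SpaceX P T} {f : L2Lkappa P T}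
    {u₀ : Vkappa P} (h : IsGeneralizedSolution u f u₀) :
    normL2D u + normLinftyV u + normDerivL2 u ≤ ENNReal.ofReal (4 * (‖f‖ + normV u₀)) := by
  obtain ⟨h1, h2⟩ := h.energy_le hT
  have hn0 : 0 ≤ normV u₀ := Real.sqrt_nonneg _
  set M := ‖f‖ + normV u₀ with hM
  have hM0 : 0 ≤ M := by positivity
  have heq : ∀ q : L2Lkappa P T, eLpNorm q 2 (timeMeasure T) = ENNReal.ofReal ‖q‖ := fun q => by
    rw [Lp.norm_def, ENNReal.ofReal_toReal (Lp.memLp q).2.ne]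
  have e1 : normDerivL2 u ≤ ENNReal.ofReal M := by
    rw [normDerivL2, heq]
    exact ENNReal.ofReal_le_ofReal h1
  have e2 : normLinftyV u ≤ ENNReal.ofReal M := by
    rw [normLinftyV, eLpNorm_exponent_top]
    refine eLpNormEssSup_le_of_ae_bound ?_
    filter_upwards [h2] with t ht
    exact (Real.norm_of_nonneg (Real.sqrt_nonneg _)).trans_le ht
  have e3 : normL2D u ≤ ENNReal.ofReal M + ENNReal.ofReal M := by
    have h3 : eLpNorm (fun t => dataOf (u.1 t)) 2 (timeMeasure T) =
        eLpNorm (⇑f - ⇑(timeDeriv u)) 2 (timeMeasure T) := by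
      refine eLpNorm_congr_ae ?_
      filter_upwards [satisfiesStokes_iff.1 h.1] with t ht
      exact eq_sub_of_add_eq' ht
    rw [normL2D, h3]
    refine (eLpNorm_sub_le (Lp.memLp f).1 (Lp.memLp _).1 (by norm_num)).trans ?_
    rw [heq, heq]
    gcongr
    linarith
  refine (add_le_add (add_le_add e3 e2) e1).trans ?_
  rw [← ENNReal.ofReal_add hM0 hM0, ← ENNReal.ofReal_add (by positivity) hM0,
    ← ENNReal.ofReal_add (by positivity) hM0]
  exact ENNReal.ofReal_le_ofReal (by linarith)

theorem IsGeneralizedSolution.unique (hT : 0 < T) {u v : SpaceX P T} {f : L2Lkappa P T}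
    {u₀ : Vkappa P} (hu : IsGeneralizedSolution u f u₀) (hv : IsGeneralizedSolution v f u₀) :
    u = v := by
  have hd : timeDeriv (u.sub v) = timeDeriv u - timeDeriv v :=
    timeDeriv_eq ((isTimeDeriv_timeDeriv u).sub (isTimeDeriv_timeDeriv v))
  have h0 : IsGeneralizedSolution (u.sub v) 0 0 := by
    refine ⟨satisfiesStokes_iff.2 ?_, ?_⟩
    · rw [hd]
      filter_upwards [satisfiesStokes_iff.1 hu.1, satisfiesStokes_iff.1 hv.1, ae_dataOf_sub u v,
        Lp.coeFn_sub (timeDeriv u) (timeDeriv v),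
        Lp.coeFn_zero (Lkappa P) 2 (timeMeasure T)] with t h1 h2 h3 h4 h5
      have h6 : dataOf ((u.sub v).1 t) = dataOf (u.1 t) - dataOf (v.1 t) := dataOf_eq h3
      rw [h4, h5, Pi.sub_apply, h6, Pi.zero_apply, sub_add_sub_comm, h1, h2, sub_self]
    · obtain ⟨U, hU, hUu, hU0⟩ := hu.2
      obtain ⟨W, hW, hWv, hW0⟩ := hv.2
      refine ⟨fun t => U t - W t, hU.sub hW, ?_, sub_eq_zero.2 (hU0.trans hW0.symm)⟩
      filter_upwards [hUu, hWv, Lp.coeFn_sub u.1 v.1] with t h1 h2 h3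
      rw [← h1, ← h2]
      exact h3
  have hz : timeDeriv (u.sub v) = 0 := by
    have := (h0.energy_le hT).1
    have hn : normV (0 : Vkappa P) = 0 := by
      have : gradInner (0 : Vkappa P) 0 = 0 := inner_zero_left _
      rw [normV, this, Real.sqrt_zero]
    rw [hn, norm_zero, add_zero] at this
    exact norm_le_zero_iff.1 this
  obtain ⟨U, hUc, hU, hUj, -⟩ := (u.sub v).exists_representative hT
  have hU0 : U 0 = 0 := HasInitialValue.unique hT ⟨U, hUc, hU, rfl⟩ h0.2
  have hUz : ∀ t ∈ Icc 0 T, U t = 0 := by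
    intro t ht
    have hpz : prim (0 : L2Lkappa P T) t = 0 := map_zero (primAt (Lkappa P) ht)
    refine toLkappa_injective ?_
    rw [hUj t ht, hz, hpz, add_zero, hU0]
  have huv : u.1 - v.1 = 0 := by
    refine Lp.ext ?_
    filter_upwards [hU, ae_restrict_mem measurableSet_Ioo,
      Lp.coeFn_zero (Vkappa P) 2 (timeMeasure T)] with t h1 ht h2
    rw [h2, Pi.zero_apply, ← hUz t (Ioo_subset_Icc_self ht)]
    exact h1
  exact Subtype.ext (sub_eq_zero.1 huv)

end MixedStokes

end

theorem mainTheorem3 (P : MixedStokes.ChannelDomain) (T : ℝ) (hT : 0 < T) :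
    (∃ c : ℝ, 0 < c ∧ ∀ (f : MixedStokes.L2Lkappa P T) (u₀ : MixedStokes.Vkappa P),
      (∃! u : MixedStokes.SpaceX P T, MixedStokes.IsGeneralizedSolution u f u₀) ∧
      ∀ u : MixedStokes.SpaceX P T, MixedStokes.IsGeneralizedSolution u f u₀ →
        MixedStokes.normL2D u + MixedStokes.normLinftyV u + MixedStokes.normDerivL2 u ≤
          ENNReal.ofReal (c * (‖f‖ + MixedStokes.normV u₀))) ∧
    (∃! S : MixedStokes.SpaceX P T → MixedStokes.SpaceY P T, MixedStokes.IsStokesOperator S) ∧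
    ∀ S : MixedStokes.SpaceX P T → MixedStokes.SpaceY P T,
      MixedStokes.IsStokesOperator S → Function.Bijective S := by
  refine ⟨⟨4, by norm_num, fun f u₀ => ⟨?_, fun u hu => hu.norm_le hT⟩⟩, ?_, fun S hS => ⟨?_, ?_⟩⟩
  · obtain ⟨u, hu⟩ := MixedStokes.exists_isGeneralizedSolution hT f u₀
    exact ⟨u, hu, fun v hv => hv.unique hT hu⟩
  · choose F hF using MixedStokes.exists_satisfiesStokes (P := P) (T := T)
    choose a ha using MixedStokes.exists_hasInitialValue (P := P) hT
    refine ⟨fun u => (F u, a u), fun u => ⟨hF u, ha u⟩, fun S hS => funext fun u => ?_⟩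
    exact Prod.ext ((hS u).1.unique (hF u)) ((hS u).2.unique hT (ha u))
  · intro u v huv
    have hv : MixedStokes.IsGeneralizedSolution v (S v).1 (S v).2 := hS v
    rw [← huv] at hv
    exact MixedStokes.IsGeneralizedSolution.unique hT (hS u) hv
  · rintro ⟨f, u₀⟩
    obtain ⟨u, hu⟩ := MixedStokes.exists_isGeneralizedSolution hT f u₀
    exact ⟨u, Prod.ext ((hS u).1.unique hu.1) ((hS u).2.unique hT hu.2)⟩
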